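/- For a field $\mathbf{k}$ and a nonconstant polynomial $v\in\mathbf{k}[h]$, let $B(v)=\mathbf{k}[x,y,h]/(xy-v(h))$ with the Poisson bracket determined by $$\{h,x\}=x,\qquad \{h,y\}=-y,\qquad \{x,y\}=-v'(h).$$ The degree $\deg b$ of $b\in B(v)$ is the least total degree of a polynomial in $x,y,h$ representing $b$. Let $W$ be the subgroup of the group of $\mathbf{k}$-algebra automorphisms of $B(v)$ generated by the automorphisms $\exp(\lambda\,\mathrm{ad}\,x^n)$ and $\exp(\lambda\,\mathrm{ad}\,y^n)$ for $\lambda\in\mathbf{k}$, $n\ge 1$ (where $\mathrm{ad}\,f=\{f,\cdot\}$, and $\exp(D)$ is the algebra automorphism whose values on the generators $x,y,h$ are given by the exponential series $\sum_j D^j/j!$, which terminates on these generators without division by zero when $\mathbf{k}$ has characteristic $p>\deg v$), and by the diagonal automorphisms $x\mapsto tx$, $y\mapsto t^{-1}y$, $h\mapsto h$ for $t\in\mathbf{k}^*$. Call $v$ reflexive if $v(h)=(-1)^{\deg v}v(a-h)$ for some $a\in\mathbf{k}$; for such an $a$, let $\Omega$ be the automorphism of $B(v)$ with $\Omega(x)=y$,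 $\Omega(y)=(-1)^{\deg v}x$, $\Omega(h)=a-h$. **Theorem.** For every natural number $d$ there is $N\in\mathbb{N}$ such that for all primes $p>N$ the following holds. Let $\mathbf{k}$ be an algebraically closed field of characteristic $p$, let $v\in\mathbf{k}[h]$ be nonconstant with $\deg v\le d$, and let $\varphi:B(v)\to B(v)$ be a Poisson $\mathbf{k}$-algebra automorphism with $\deg\varphi(x)\le d$ and $\deg\varphi(y)\le d$. Then $\varphi$ belongs to the subgroup generated by $W$ and $\Omega$ if $v$ is reflexive (for any admissible $a$), and $\varphi\in W$ if $v$ is not reflexive. -/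

import Mathlib

namespace TypeAPoisson

section Ring

variable {k : Type*} [Field k]

/-- The polynomial `x y - v(h)` in `k[x, y, h]`, the variables being numbered `0, 1, 2`. -/
noncomputable def relation (v : Polynomial k) : MvPolynomial (Fin 3) k :=
  MvPolynomial.X 0 * MvPolynomial.X 1 - Polynomial.aeval (MvPolynomial.X 2) v

/-- The coordinate ring `B(v) = k[x, y, h] / (x y - v(h))`. -/
def B (v : Polynomial k) : Type _ :=
  MvPolynomial (Fin 3) k ⧸ Ideal.span {relation v}

noncomputable instance (v : Polynomial k) : CommRing (B v) :=
  inferInstanceAs (CommRing (MvPolynomial (Fin 3) k ⧸ Ideal.span {relation v}))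

noncomputable instance (v : Polynomial k) : Algebra k (B v) :=
  inferInstanceAs (Algebra k (MvPolynomial (Fin 3) k ⧸ Ideal.span {relation v}))

/-- The projection `k[x, y, h] → B(v)`. -/
noncomputable def proj (v : Polynomial k) : MvPolynomial (Fin 3) k →ₐ[k] B v :=
  Ideal.Quotient.mkₐ k (Ideal.span {relation v})

theorem proj_surjective (v : Polynomial k) : Function.Surjective (proj v) :=
  Ideal.Quotient.mkₐ_surjective k (Ideal.span {relation v})

theorem proj_eq_proj_iff (v : Polynomial k) (f g : MvPolynomial (Fin 3) k) :
    proj v f = proj v g ↔ f - g ∈ Ideal.span {relation v} :=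
  Ideal.Quotient.eq

/-- The generator `x` of `B(v)`. -/
noncomputable def x (v : Polynomial k) : B v := proj v (MvPolynomial.X 0)

/-- The generator `y` of `B(v)`. -/
noncomputable def y (v : Polynomial k) : B v := proj v (MvPolynomial.X 1)

/-- The generator `h` of `B(v)`. -/
noncomputable def h (v : Polynomial k) : B v := proj v (MvPolynomial.X 2)

theorem proj_aeval (v w : Polynomial k) :
    proj v (Polynomial.aeval (MvPolynomial.X 2) w) = Polynomial.aeval (h v) w :=
  (Polynomial.aeval_algHom_apply (proj v) (MvPolynomial.X 2) w).symm

theorem proj_relation (v : Polynomial k) : proj v (relation v) = 0 :=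
  Ideal.Quotient.eq_zero_iff_mem.mpr (Ideal.subset_span rfl)

theorem x_mul_y (v : Polynomial k) : x v * y v = Polynomial.aeval (h v) v := by
  have e := proj_relation v
  have e2 : proj v (relation v) = x v * y v - Polynomial.aeval (h v) v := by
    rw [← proj_aeval]
    simp only [relation, map_sub, map_mul, x, y]
  rw [e2] at e
  exact sub_eq_zero.mp e

/-- The universal property of `B(v)`: elements `a, b, c` with `a b = v(c)` define a homomorphism
with `x ↦ a`, `y ↦ b`, `h ↦ c`. -/
noncomputable def lift (v : Polynomial k) {A : Type*} [CommRing A] [Algebra k A] (a b c : A)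
    (e : a * b = Polynomial.aeval c v) : B v →ₐ[k] A :=
  Ideal.Quotient.liftₐ (Ideal.span {relation v}) (MvPolynomial.aeval ![a, b, c]) (by
    intro q hq
    have hle : Ideal.span {relation v} ≤ RingHom.ker (MvPolynomial.aeval (R := k) ![a, b, c]) := by
      rw [Ideal.span_singleton_le_iff_mem, RingHom.mem_ker, relation, map_sub, map_mul,
        ← Polynomial.aeval_algHom_apply]
      simp [e]
    exact hle hq)

section Lift

variable (v : Polynomial k) {A : Type*} [CommRing A] [Algebra k A] (a b c : A)
  (e : a * b = Polynomial.aeval c v)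

theorem lift_x : lift v a b c e (x v) = a := by
  change MvPolynomial.aeval ![a, b, c] (MvPolynomial.X 0) = a
  simp

theorem lift_y : lift v a b c e (y v) = b := by
  change MvPolynomial.aeval ![a, b, c] (MvPolynomial.X 1) = b
  simp

theorem lift_h : lift v a b c e (h v) = c := by
  change MvPolynomial.aeval ![a, b, c] (MvPolynomial.X 2) = c
  simp

end Lift

theorem algHom_ext {v : Polynomial k} {A : Type*} [CommRing A] [Algebra k A] {f g : B v →ₐ[k] A}
    (ex : f (x v) = g (x v)) (ey : f (y v) = g (y v)) (eh : f (h v) = g (h v)) : f = g := by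
  apply Ideal.Quotient.algHom_ext
  apply MvPolynomial.algHom_ext
  intro i
  fin_cases i
  · exact ex
  · exact ey
  · exact eh

/-- The degree of an element of `B(v)`: the least total degree of a polynomial in `x, y, h`
representing it (so `deg 0 = 0`). -/
noncomputable def deg {v : Polynomial k} (b : B v) : ℕ :=
  sInf {n | ∃ q : MvPolynomial (Fin 3) k, proj v q = b ∧ q.totalDegree = n}

end Ring

section Bracket

variable {k : Type*} [Field k]

/-- The biderivation of `k[x, y, h]` with `{h, x} = x`, `{h, y} = -y`, `{x, y} = -v'(h)`. -/
noncomputable def polyBracket (v : Polynomial k) (f g : MvPolynomial (Fin 3) k) :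
    MvPolynomial (Fin 3) k :=
  MvPolynomial.X 0 * (MvPolynomial.pderiv 2 f * MvPolynomial.pderiv 0 g
      - MvPolynomial.pderiv 0 f * MvPolynomial.pderiv 2 g)
    - MvPolynomial.X 1 * (MvPolynomial.pderiv 2 f * MvPolynomial.pderiv 1 g
      - MvPolynomial.pderiv 1 f * MvPolynomial.pderiv 2 g)
    - Polynomial.aeval (MvPolynomial.X 2) (Polynomial.derivative v)
      * (MvPolynomial.pderiv 0 f * MvPolynomial.pderiv 1 g
        - MvPolynomial.pderiv 1 f * MvPolynomial.pderiv 0 g)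

theorem pderiv_aeval (i : Fin 3) (v : Polynomial k) :
    MvPolynomial.pderiv i (Polynomial.aeval (MvPolynomial.X 2 : MvPolynomial (Fin 3) k) v)
      = Polynomial.aeval (MvPolynomial.X 2) (Polynomial.derivative v)
        * MvPolynomial.pderiv i (MvPolynomial.X 2) := by
  rw [Derivation.map_aeval, smul_eq_mul]

theorem polyBracket_swap (v : Polynomial k) (f g : MvPolynomial (Fin 3) k) :
    polyBracket v g f = - polyBracket v f g := by
  unfold polyBracket
  ring

theorem polyBracket_add (v : Polynomial k) (f g₁ g₂ : MvPolynomial (Fin 3) k) :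
    polyBracket v f (g₁ + g₂) = polyBracket v f g₁ + polyBracket v f g₂ := by
  simp only [polyBracket, map_add]
  ring

theorem polyBracket_mul (v : Polynomial k) (f g₁ g₂ : MvPolynomial (Fin 3) k) :
    polyBracket v f (g₁ * g₂) = polyBracket v f g₁ * g₂ + g₁ * polyBracket v f g₂ := by
  simp only [polyBracket, Derivation.leibniz, smul_eq_mul]
  ring

theorem pderiv_comm (i j : Fin 3) (q : MvPolynomial (Fin 3) k) :
    MvPolynomial.pderiv i (MvPolynomial.pderiv j q)
      = MvPolynomial.pderiv j (MvPolynomial.pderiv i q) := by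
  have e0 : ⁅(MvPolynomial.pderiv i : Derivation k (MvPolynomial (Fin 3) k)
      (MvPolynomial (Fin 3) k)),
      (MvPolynomial.pderiv j : Derivation k (MvPolynomial (Fin 3) k)
        (MvPolynomial (Fin 3) k))⁆ = 0 := by
    apply MvPolynomial.derivation_ext
    intro l
    simp only [Derivation.commutator_apply, MvPolynomial.pderiv_X, Pi.single_apply]
    split_ifs <;> simp
  have e := congrArg (fun D : Derivation k (MvPolynomial (Fin 3) k) (MvPolynomial (Fin 3) k) =>
    D q) e0
  simpa [Derivation.commutator_apply, sub_eq_zero] using e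

theorem polyBracket_jacobi (v : Polynomial k) (f g w : MvPolynomial (Fin 3) k) :
    polyBracket v f (polyBracket v g w)
      = polyBracket v (polyBracket v f g) w + polyBracket v g (polyBracket v f w) := by
  simp only [polyBracket, map_sub, Derivation.leibniz, smul_eq_mul, pderiv_aeval,
    MvPolynomial.pderiv_X]
  rw [pderiv_comm 1 0 f, pderiv_comm 2 0 f, pderiv_comm 2 1 f, pderiv_comm 1 0 g,
    pderiv_comm 2 0 g, pderiv_comm 2 1 g, pderiv_comm 1 0 w, pderiv_comm 2 0 w,
    pderiv_comm 2 1 w]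
  simp
  ring

theorem polyBracket_relation (v : Polynomial k) (f : MvPolynomial (Fin 3) k) :
    polyBracket v f (relation v) = 0 := by
  simp only [polyBracket, relation, map_sub, Derivation.leibniz, smul_eq_mul, pderiv_aeval,
    MvPolynomial.pderiv_X]
  simp
  ring

theorem proj_polyBracket_right (v : Polynomial k) (f g₁ g₂ : MvPolynomial (Fin 3) k)
    (hg : proj v g₁ = proj v g₂) :
    proj v (polyBracket v f g₁) = proj v (polyBracket v f g₂) := by
  obtain ⟨q, hq⟩ := Ideal.mem_span_singleton'.mp ((proj_eq_proj_iff v _ _).mp hg)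
  have e : g₁ = g₂ + q * relation v := by rw [hq]; ring
  rw [e, polyBracket_add, polyBracket_mul, polyBracket_relation, map_add, map_add, map_mul,
    proj_relation]
  simp

theorem proj_polyBracket (v : Polynomial k) {f₁ f₂ g₁ g₂ : MvPolynomial (Fin 3) k}
    (hf : proj v f₁ = proj v f₂) (hg : proj v g₁ = proj v g₂) :
    proj v (polyBracket v f₁ g₁) = proj v (polyBracket v f₂ g₂) := by
  rw [proj_polyBracket_right v f₁ g₁ g₂ hg, ← neg_inj, ← map_neg, ← map_neg,
    ← polyBracket_swap, ← polyBracket_swap, proj_polyBracket_right v g₂ f₁ f₂ hf]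

/-- The Poisson bracket of `B(v)`, induced by `polyBracket`. -/
noncomputable def bracket {v : Polynomial k} (f g : B v) : B v :=
  Quotient.liftOn₂' f g (fun p q => proj v (polyBracket v p q)) (by
    intro p₁ q₁ p₂ q₂ hp hq
    exact proj_polyBracket v (Quotient.sound' hp) (Quotient.sound' hq))

theorem bracket_proj (v : Polynomial k) (f g : MvPolynomial (Fin 3) k) :
    bracket (proj v f) (proj v g) = proj v (polyBracket v f g) := rfl

theorem bracket_h_x (v : Polynomial k) : bracket (h v) (x v) = x v := by
  simp [h, x, bracket_proj, polyBracket, MvPolynomial.pderiv_X]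

theorem bracket_h_y (v : Polynomial k) : bracket (h v) (y v) = - y v := by
  simp [h, y, bracket_proj, polyBracket, MvPolynomial.pderiv_X]

theorem bracket_x_y (v : Polynomial k) :
    bracket (x v) (y v) = - Polynomial.aeval (h v) (Polynomial.derivative v) := by
  rw [← proj_aeval]
  simp [x, y, bracket_proj, polyBracket, MvPolynomial.pderiv_X]

theorem bracket_swap {v : Polynomial k} (f g : B v) : bracket g f = - bracket f g := by
  obtain ⟨f, rfl⟩ := proj_surjective _ f
  obtain ⟨g, rfl⟩ := proj_surjective _ g
  rw [bracket_proj, bracket_proj, polyBracket_swap, map_neg]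

theorem bracket_add {v : Polynomial k} (f g₁ g₂ : B v) :
    bracket f (g₁ + g₂) = bracket f g₁ + bracket f g₂ := by
  obtain ⟨f, rfl⟩ := proj_surjective _ f
  obtain ⟨g₁, rfl⟩ := proj_surjective _ g₁
  obtain ⟨g₂, rfl⟩ := proj_surjective _ g₂
  rw [← map_add, bracket_proj, bracket_proj, bracket_proj, polyBracket_add, map_add]

theorem bracket_mul {v : Polynomial k} (f g₁ g₂ : B v) :
    bracket f (g₁ * g₂) = bracket f g₁ * g₂ + g₁ * bracket f g₂ := by
  obtain ⟨f, rfl⟩ := proj_surjective _ f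
  obtain ⟨g₁, rfl⟩ := proj_surjective _ g₁
  obtain ⟨g₂, rfl⟩ := proj_surjective _ g₂
  rw [← map_mul, bracket_proj, bracket_proj, bracket_proj, polyBracket_mul, map_add, map_mul,
    map_mul]

theorem bracket_jacobi {v : Polynomial k} (f g w : B v) :
    bracket f (bracket g w) = bracket (bracket f g) w + bracket g (bracket f w) := by
  obtain ⟨f, rfl⟩ := proj_surjective _ f
  obtain ⟨g, rfl⟩ := proj_surjective _ g
  obtain ⟨w, rfl⟩ := proj_surjective _ w
  simp only [bracket_proj]
  rw [polyBracket_jacobi, map_add]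

/-- `φ` is a Poisson automorphism of `B(v)`. -/
def IsPoisson {v : Polynomial k} (φ : B v ≃ₐ[k] B v) : Prop :=
  ∀ f g : B v, φ (bracket f g) = bracket (φ f) (φ g)

end Bracket

section Groups

variable {k : Type*} [Field k]

/-- The diagonal automorphism `x ↦ t x`, `y ↦ t⁻¹ y`, `h ↦ h`. -/
noncomputable def diagonal (v : Polynomial k) (t : kˣ) : B v ≃ₐ[k] B v :=
  have e : ∀ s : kˣ, ((s : k) • x v) * ((s⁻¹ : kˣ) : k) • y v = Polynomial.aeval (h v) v := by
    intro s
    rw [smul_mul_smul_comm, Units.mul_inv, one_smul, x_mul_y]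
  AlgEquiv.ofAlgHom
    (lift v ((t : k) • x v) (((t⁻¹ : kˣ) : k) • y v) (h v) (e t))
    (lift v (((t⁻¹ : kˣ) : k) • x v) ((((t⁻¹)⁻¹ : kˣ) : k) • y v) (h v) (e t⁻¹))
    (by apply algHom_ext <;> simp [lift_x, lift_y, lift_h, smul_smul])
    (by apply algHom_ext <;> simp [lift_x, lift_y, lift_h, smul_smul])

/-- `φ = exp(D)` as an automorphism of the algebra `B(v)`: on each of the generators `x, y, h` the
series `∑ D^j / j!` terminates, with no division by zero in `k`, and its sum is the value of `φ`.
(In characteristic `p` the series need not make sense on other elements, such as `h ^ p`; an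
automorphism is determined by its values on the generators.) -/
def IsExp {v : Polynomial k} (D : B v → B v) (φ : B v ≃ₐ[k] B v) : Prop :=
  ∀ g ∈ ({x v, y v, h v} : Set (B v)), ∃ m : ℕ,
    (∀ j < m, (j.factorial : k) ≠ 0) ∧ D^[m] g = 0 ∧
      φ g = ∑ j ∈ Finset.range m, (j.factorial : k)⁻¹ • D^[j] g

/-- The group `W` generated by `exp(c ad x^n)`, `exp(c ad y^n)` (`c ∈ k`, `n ≥ 1`), where
`ad f = {f, ·}`, and the diagonal automorphisms. -/
noncomputable def W (v : Polynomial k) : Subgroup (B v ≃ₐ[k] B v) :=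
  Subgroup.closure
    ({φ | ∃ (c : k) (n : ℕ), 1 ≤ n ∧ IsExp (fun b => c • bracket (x v ^ n) b) φ} ∪
      {φ | ∃ (c : k) (n : ℕ), 1 ≤ n ∧ IsExp (fun b => c • bracket (y v ^ n) b) φ} ∪
      Set.range (diagonal v))

/-- `v(h) = (-1)^(deg v) v(a - h)`. -/
def IsReflexiveAt (v : Polynomial k) (a : k) : Prop :=
  v = (-1) ^ v.natDegree * v.comp (Polynomial.C a - Polynomial.X)

/-- `v` is reflexive. -/
def IsReflexive (v : Polynomial k) : Prop := ∃ a : k, IsReflexiveAt v a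

theorem IsReflexiveAt.aeval {v : Polynomial k} {a : k} (ha : IsReflexiveAt v a) :
    Polynomial.aeval (algebraMap k (B v) a - h v) v
      = (-1) ^ v.natDegree * Polynomial.aeval (h v) v := by
  have e := congrArg (Polynomial.aeval (h v)) ha
  rw [map_mul, Polynomial.aeval_comp] at e
  simp only [map_pow, map_neg, map_one, map_sub, Polynomial.aeval_C, Polynomial.aeval_X] at e
  rw [e, ← mul_assoc, ← mul_pow, neg_one_mul, neg_neg, one_pow, one_mul]

/-- The automorphism `x ↦ y`, `y ↦ (-1)^(deg v) x`, `h ↦ a - h` of `B(v)`, for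
`v(h) = (-1)^(deg v) v(a - h)`. -/
noncomputable def Omega (v : Polynomial k) (a : k) (ha : IsReflexiveAt v a) : B v ≃ₐ[k] B v :=
  AlgEquiv.ofAlgHom
    (lift v (y v) ((-1) ^ v.natDegree * x v) (algebraMap k (B v) a - h v) (by
      rw [ha.aeval, ← x_mul_y]; ring))
    (lift v ((-1) ^ v.natDegree * y v) (x v) (algebraMap k (B v) a - h v) (by
      rw [ha.aeval, ← x_mul_y]; ring))
    (by apply algHom_ext <;>
      simp [lift_x, lift_y, lift_h, ← mul_assoc, ← pow_add, Even.neg_one_pow ⟨v.natDegree, rfl⟩])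
    (by apply algHom_ext <;>
      simp [lift_x, lift_y, lift_h, ← mul_assoc, ← pow_add, Even.neg_one_pow ⟨v.natDegree, rfl⟩])

end Groups

end TypeAPoisson

/-! Substituting v(h)/x for y embeds B(v) in a Laurent polynomial ring where the bracket of two
monomials with exponents e, e' is det(e, e') times the monomial with exponent e + e' - `eh`
(`iota_bracket`). Exponents are ordered by weight, then by degree in h; x has weight 1, h has weight
3, so y has weight 3n - 1 with n = deg v. Let eX, eY, eH be the leading exponents of φ(x), φ(y),
φ(h). The relation xy = v(h) gives eX + eY = n eH, and exchanging x and y if necessary one may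
assume wt eX ≤ wt eY. The exchange reverses the sign of the bracket and normalizes W, which is why
maps scaling the bracket by ε are carried along.

Apply φ to {h, x} = x. If det(eH, eX) is nonzero in k, leading terms do not cancel, which forces eH
= `eh` and eX = `ex`; elements of W then make φ(x) a multiple of x and φ(h) equal to εh + q
(`exists_isAffine`). The relation xy = v(h) gives v(εh + q) = ε^n v(h): for ε = 1 this means q = 0
and a diagonal map, for ε = -1 it says that v is reflexive. If the determinant is zero in k, it is
zero in ℤ because the weights are small compared with p. Then eX and eH are proportional, and as
soon as wt eX divides wt eH, a shear h ↦ h + μx^m cancels the leading term of φ(h), so that one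
descends on eH (`isReduced_or_exists_shear`, `exists_isReduced`). All weights stay bounded by n wt
eH, which never grows, so one lower bound for p serves the whole descent.

The crux is the divisibility `wt_dvd_wt_of_wt_le`. Write x = φ(g). The part of g that is heaviest
when x, h are given the exponents eX, eH becomes, after clearing denominators, essentially a
polynomial Q(h), and cancellation in φ(g) is measured by the multiplicity l of a root of Q. Applying
ad x to g differentiates Q, so after l applications the expected leading term survives; on the other
side, l brackets with φ(x) raise the exponent of x by a bounded amount. If divisibility fails, the
exponents in Q lie in one class modulo some b' ≥ 2, hence l ≤ deg Q / 2, and the two estimates clash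
(`false_of_weights`). Dividing by l! requires l < p, which follows from a bound on the inverse of φ
by an intersection count (`top_le_natDegree_ev`). -/

namespace TypeAPoisson

/-! ### Leading terms in the group algebra of the ordered group of exponents -/

/-- Exponents, ordered lexicographically. -/
def Expo : Type := ℤ ×ₗ ℤ

instance : AddCommGroup Expo := inferInstanceAs (AddCommGroup (ℤ ×ₗ ℤ))

noncomputable instance : LinearOrder Expo := inferInstanceAs (LinearOrder (ℤ ×ₗ ℤ))

instance : IsOrderedAddMonoid Expo := inferInstanceAs (IsOrderedAddMonoid (ℤ ×ₗ ℤ))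

/-- The first coordinate (the weight) of an exponent. -/
def wt : Expo →+ ℤ where
  toFun e := (ofLex e).1
  map_zero' := rfl
  map_add' _ _ := rfl

/-- The second coordinate (the degree in `h`) of an exponent. -/
def hdeg : Expo →+ ℤ where
  toFun e := (ofLex e).2
  map_zero' := rfl
  map_add' _ _ := rfl

theorem Expo.ext {a b : Expo} (h1 : wt a = wt b) (h2 : hdeg a = hdeg b) : a = b :=
  Prod.ext h1 h2

theorem Expo.lt_iff {a b : Expo} : a < b ↔ wt a < wt b ∨ wt a = wt b ∧ hdeg a < hdeg b :=
  Prod.Lex.lt_iff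

theorem Expo.le_iff {a b : Expo} : a ≤ b ↔ wt a < wt b ∨ wt a = wt b ∧ hdeg a ≤ hdeg b :=
  Prod.Lex.le_iff

theorem wt_mono {a b : Expo} (hab : a ≤ b) : wt a ≤ wt b := by
  rcases Expo.le_iff.mp hab with h | h
  · exact h.le
  · exact h.1.le

section Lead

variable {k : Type*} [Field k]

/-- All coefficients of `f` above `e` vanish, and the coefficient at `e` is `c` (possibly `0`). -/
def Lead (f : AddMonoidAlgebra k Expo) (e : Expo) (c : k) : Prop :=
  (∀ d, e < d → f.coeff d = 0) ∧ f.coeff e = c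

variable {f g : AddMonoidAlgebra k Expo} {e e' : Expo} {c c' : k}

theorem Lead.congr (hf : Lead f e c) (hfg : f = g) (he : e = e') (hc : c = c') :
    Lead g e' c' := hfg ▸ he ▸ hc ▸ hf

theorem Lead.zero (e : Expo) : Lead (0 : AddMonoidAlgebra k Expo) e 0 := by
  simp [Lead]

theorem lead_single (e : Expo) (c : k) : Lead (AddMonoidAlgebra.single e c) e c := by
  refine ⟨fun d hd => ?_, by simp⟩
  simp [hd.ne]

theorem Lead.add (hf : Lead f e c) (hg : Lead g e c') : Lead (f + g) e (c + c') :=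
  ⟨fun d hd => by simp [hf.1 d hd, hg.1 d hd], by simp [hf.2, hg.2]⟩

theorem Lead.smul (a : k) (hf : Lead f e c) : Lead (a • f) e (a * c) :=
  ⟨fun d hd => by simp [hf.1 d hd], by simp [hf.2]⟩

theorem Lead.neg (hf : Lead f e c) : Lead (-f) e (-c) := by
  simpa using hf.smul (-1)

theorem Lead.sub (hf : Lead f e c) (hg : Lead g e c') : Lead (f - g) e (c - c') := by
  simpa [sub_eq_add_neg] using hf.add hg.neg

theorem Lead.of_lt (hf : Lead f e c) (h : e < e') : Lead f e' 0 :=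
  ⟨fun d hd => hf.1 d (h.trans hd), hf.1 e' h⟩

theorem Lead.le (hf : Lead f e c) (hg : Lead f e' c') (hc : c ≠ 0) : e ≤ e' := by
  by_contra! hlt
  exact hc (hf.2 ▸ hg.1 e hlt)

theorem Lead.unique (hf : Lead f e c) (hg : Lead f e' c') (hc : c ≠ 0) (hc' : c' ≠ 0) : e = e' :=
  le_antisymm (hf.le hg hc) (hg.le hf hc')

theorem Lead.unique_coeff (hf : Lead f e c) (hg : Lead f e c') : c = c' :=
  hf.2.symm.trans hg.2

theorem Lead.ne_zero (hf : Lead f e c) (hc : c ≠ 0) : f ≠ 0 := by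
  rintro rfl
  exact hc (by simpa using hf.2.symm)

theorem Lead.sum {ι : Type*} (s : Finset ι) (F : ι → AddMonoidAlgebra k Expo) (a : ι → k)
    (hF : ∀ i ∈ s, Lead (F i) e (a i)) : Lead (∑ i ∈ s, F i) e (∑ i ∈ s, a i) := by
  classical
  induction s using Finset.induction_on with
  | empty => simpa using Lead.zero e
  | insert i s hi ih =>
    rw [Finset.sum_insert hi, Finset.sum_insert hi]
    exact (hF i (by simp)).add (ih fun j hj => hF j (by simp [hj]))

theorem coeff_mul_eq (f g : AddMonoidAlgebra k Expo) (d : Expo) :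
    (f * g).coeff d = ∑ a ∈ f.coeff.support, f.coeff a * g.coeff (d - a) := by
  classical
  rw [AddMonoidAlgebra.coeff_mul]
  simp only [Finsupp.sum]
  refine Finset.sum_congr rfl fun a _ => ?_
  have : ∀ b, (a + b = d) ↔ (b = d - a) := fun b => by
    constructor
    · rintro rfl; abel
    · rintro rfl; abel
  simp only [this, Finset.sum_ite_eq']
  split_ifs with hh
  · rfl
  · rw [Finsupp.notMem_support_iff.mp hh, mul_zero]

theorem Lead.mul (hf : Lead f e c) (hg : Lead g e' c') : Lead (f * g) (e + e') (c * c') := by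
  constructor
  · intro d hd
    rw [coeff_mul_eq]
    refine Finset.sum_eq_zero fun a _ => ?_
    rcases lt_or_ge e a with h | h
    · rw [hf.1 a h, zero_mul]
    · rw [hg.1 (d - a), mul_zero]
      have := (add_le_add_left h e').trans_lt hd
      exact lt_sub_iff_add_lt'.mpr this
  · rw [coeff_mul_eq, Finset.sum_eq_single e]
    · rw [hf.2, add_sub_cancel_left, hg.2]
    · intro a _ ha
      rcases lt_or_ge e a with h | h
      · rw [hf.1 a h, zero_mul]
      · have h := lt_of_le_of_ne h ha
        rw [hg.1 (e + e' - a), mul_zero]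
        exact lt_sub_iff_add_lt'.mpr (add_lt_add_left h e')
    · intro h
      rw [Finsupp.notMem_support_iff.mp h, zero_mul]

theorem lead_one : Lead (1 : AddMonoidAlgebra k Expo) 0 1 := lead_single 0 1

theorem Lead.pow (hf : Lead f e c) (m : ℕ) : Lead (f ^ m) (m • e) (c ^ m) := by
  induction m with
  | zero => simpa using lead_one
  | succ m ih =>
    rw [pow_succ, pow_succ, succ_nsmul]
    exact ih.mul hf

theorem lead_algebraMap (c : k) : Lead (algebraMap k (AddMonoidAlgebra k Expo) c) 0 c := by
  rw [Algebra.algebraMap_eq_smul_one]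
  simpa using lead_one.smul c

/-- Only an upper bound for the degree is assumed, so the coefficient may vanish; this matters for
iterated derivatives in characteristic p. -/
theorem Lead.aeval (hf : Lead f e c) (he : 0 < e) (P : Polynomial k) {N : ℕ}
    (hN : P.natDegree ≤ N) : Lead (Polynomial.aeval f P) (N • e) (P.coeff N * c ^ N) := by
  rw [Polynomial.aeval_eq_sum_range' (Nat.lt_succ_of_le hN)]
  have hs := Lead.sum (e := N • e) (Finset.range N.succ) (fun i => P.coeff i • f ^ i)
    (fun i => if i = N then P.coeff N * c ^ N else 0) (fun i hi => by
      have h0 := (hf.pow i).smul (P.coeff i)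
      split_ifs with hiN
      · subst hiN; exact h0
      · refine h0.of_lt (nsmul_lt_nsmul_left he ?_)
        exact lt_of_le_of_ne (Nat.lt_succ_iff.mp (Finset.mem_range.mp hi)) hiN)
  simpa using hs

theorem exists_lead (hf : f ≠ 0) : ∃ e c, c ≠ 0 ∧ Lead f e c := by
  have hs : f.coeff.support.Nonempty := by
    rw [Finsupp.support_nonempty_iff]
    simpa using hf
  refine ⟨f.coeff.support.max' hs, _, ?_, fun d hd => ?_, rfl⟩
  · exact Finsupp.mem_support_iff.mp (Finset.max'_mem _ hs)
  · by_contra hne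
    exact absurd (Finset.le_max' _ _ (Finsupp.mem_support_iff.mpr hne)) (not_le.mpr hd)

theorem coeff_mul_eq_of_subset (f g : AddMonoidAlgebra k Expo) (d : Expo) {s : Finset Expo}
    (hs : f.coeff.support ⊆ s) : (f * g).coeff d = ∑ a ∈ s, f.coeff a * g.coeff (d - a) := by
  rw [coeff_mul_eq]
  refine Finset.sum_subset hs fun a _ ha => ?_
  rw [Finsupp.notMem_support_iff.mp ha, zero_mul]

/-- The linear map multiplying the coefficient at `e` by `χ e`. -/
noncomputable def eulerLinear (k : Type*) [Field k] (χ : Expo →+ ℤ) :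
    AddMonoidAlgebra k Expo →ₗ[k] AddMonoidAlgebra k Expo where
  toFun f := AddMonoidAlgebra.ofCoeff
    (Finsupp.onFinset f.coeff.support (fun a => (χ a : k) * f.coeff a) fun a ha =>
      Finsupp.mem_support_iff.mpr (right_ne_zero_of_mul ha))
  map_add' f g := by
    ext a
    simp [mul_add]
  map_smul' c f := by
    ext a
    simp only [AddMonoidAlgebra.coeff_smul, Finsupp.onFinset_apply, Finsupp.smul_apply,
      smul_eq_mul, RingHom.id_apply]
    ring

theorem coeff_eulerLinear (χ : Expo →+ ℤ) (f : AddMonoidAlgebra k Expo) (a : Expo) :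
    (eulerLinear k χ f).coeff a = (χ a : k) * f.coeff a := rfl

/-- The Euler derivation attached to an additive character of the exponents. -/
noncomputable def euler (k : Type*) [Field k] (χ : Expo →+ ℤ) :
    Derivation k (AddMonoidAlgebra k Expo) (AddMonoidAlgebra k Expo) :=
  Derivation.mk' (eulerLinear k χ) (by
    intro f g
    rw [smul_eq_mul, smul_eq_mul, mul_comm g]
    ext d
    rw [AddMonoidAlgebra.coeff_add, Finsupp.add_apply, coeff_eulerLinear, coeff_mul_eq,
      coeff_mul_eq, coeff_mul_eq_of_subset (eulerLinear k χ f) g d (s := f.coeff.support)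
        (by
          intro a ha
          rw [Finsupp.mem_support_iff, coeff_eulerLinear] at ha
          exact Finsupp.mem_support_iff.mpr (right_ne_zero_of_mul ha)),
      ← Finset.sum_add_distrib, Finset.mul_sum]
    refine Finset.sum_congr rfl fun a _ => ?_
    rw [coeff_eulerLinear, coeff_eulerLinear, map_sub χ]
    push_cast
    ring)

theorem coeff_euler (χ : Expo →+ ℤ) (f : AddMonoidAlgebra k Expo) (a : Expo) :
    (euler k χ f).coeff a = (χ a : k) * f.coeff a := rfl

theorem euler_single (χ : Expo →+ ℤ) (a : Expo) (c : k) :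
    euler k χ (AddMonoidAlgebra.single a c) = AddMonoidAlgebra.single a ((χ a : k) * c) := by
  classical
  ext b
  rw [coeff_euler, AddMonoidAlgebra.coeff_single, AddMonoidAlgebra.coeff_single,
    Finsupp.single_apply, Finsupp.single_apply]
  split_ifs with hab
  · rw [hab]
  · rw [mul_zero]

theorem Lead.euler (χ : Expo →+ ℤ) (hf : Lead f e c) : Lead (euler k χ f) e ((χ e : k) * c) :=
  ⟨fun d hd => by rw [coeff_euler, hf.1 d hd, mul_zero], by rw [coeff_euler, hf.2]⟩

/-- The exponent of `x`. -/
def ex : Expo := toLex (1, 0)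

/-- The exponent of `h`. -/
def eh : Expo := toLex (3, 1)

@[simp] theorem wt_ex : wt ex = 1 := rfl
@[simp] theorem hdeg_ex : hdeg ex = 0 := rfl
@[simp] theorem wt_eh : wt eh = 3 := rfl
@[simp] theorem hdeg_eh : hdeg eh = 1 := rfl

theorem ex_pos : 0 < ex := Expo.lt_iff.mpr (by simp)
theorem eh_pos : 0 < eh := Expo.lt_iff.mpr (by simp)

/-- The determinant of two exponents. -/
def expoDet (a b : Expo) : ℤ := hdeg a * wt b - wt a * hdeg b

/-- The bracket of monomial type on the group algebra of the exponents that extends the bracket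
of `B(v)`. -/
noncomputable def torusBracket (f g : AddMonoidAlgebra k Expo) : AddMonoidAlgebra k Expo :=
  AddMonoidAlgebra.single (-eh) 1 *
    (euler k hdeg f * euler k wt g - euler k wt f * euler k hdeg g)

/-- Euler derivations act on a leading term by a scalar, so the bracket contributes the determinant.
It may be zero in k, and then only an upper bound for the exponent remains. -/
theorem Lead.torusBracket (hf : Lead f e c) (hg : Lead g e' c') :
    Lead (torusBracket f g) (e + e' - eh) ((expoDet e e' : k) * (c * c')) := by
  have h1 := (lead_single (-eh) (1 : k)).mul
    (((hf.euler hdeg).mul (hg.euler wt)).sub ((hf.euler wt).mul (hg.euler hdeg)))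
  refine h1.congr rfl (by abel) ?_
  rw [expoDet]; push_cast; ring

end Lead

/-! ### The embedding of B(v) in the Laurent polynomial ring -/

section Embedding

variable {k : Type*} [Field k]

local notation "T" => AddMonoidAlgebra.single

/-- The embedding of `B(v)` in a Laurent polynomial ring, with `y = v(h) / x`. -/
noncomputable def iota (v : Polynomial k) : B v →ₐ[k] AddMonoidAlgebra k Expo :=
  lift v (T ex 1) (T (-ex) 1 * Polynomial.aeval (T eh 1) v) (T eh 1) (by
    rw [← mul_assoc, AddMonoidAlgebra.single_mul_single, add_neg_cancel, one_mul,
      ← AddMonoidAlgebra.one_def, one_mul])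

theorem iota_x (v : Polynomial k) : iota v (x v) = T ex 1 := lift_x v _ _ _ _
theorem iota_y (v : Polynomial k) :
    iota v (y v) = T (-ex) 1 * Polynomial.aeval (T eh 1) v := lift_y v _ _ _ _
theorem iota_h (v : Polynomial k) : iota v (h v) = T eh 1 := lift_h v _ _ _ _

theorem lead_iota_x (v : Polynomial k) : Lead (iota v (x v)) ex 1 := by
  rw [iota_x]; exact lead_single _ _

theorem lead_iota_h (v : Polynomial k) : Lead (iota v (h v)) eh 1 := by
  rw [iota_h]; exact lead_single _ _

theorem lead_iota_y (v : Polynomial k) :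
    Lead (iota v (y v)) (v.natDegree • eh - ex) v.leadingCoeff := by
  rw [iota_y]
  exact ((lead_single (-ex) (1 : k)).mul
    ((lead_single eh (1 : k)).aeval eh_pos v le_rfl)).congr rfl (by abel) (by simp)

theorem derivation_mvPolynomial_aeval {A : Type*} [CommRing A] [Algebra k A]
    (D : Derivation k A A) (φ : MvPolynomial (Fin 3) k →ₐ[k] A) (p : MvPolynomial (Fin 3) k) :
    D (φ p) = φ (MvPolynomial.pderiv 0 p) * D (φ (MvPolynomial.X 0))
      + φ (MvPolynomial.pderiv 1 p) * D (φ (MvPolynomial.X 1))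
      + φ (MvPolynomial.pderiv 2 p) * D (φ (MvPolynomial.X 2)) := by
  induction p using MvPolynomial.induction_on with
  | C a =>
    simp [show (MvPolynomial.C a : MvPolynomial (Fin 3) k) = algebraMap k _ a from rfl]
  | add p q hp hq =>
    simp only [map_add, hp, hq]; ring
  | mul_X p i hp =>
    simp only [map_mul, Derivation.leibniz, smul_eq_mul, hp, map_add, MvPolynomial.pderiv_X]
    fin_cases i <;> simp <;> ring

/-- By the chain rule for the Euler derivations both sides are bilinear in the partial derivatives
of f and g, with coefficients given by the generators. They agree modulo the two facts that the
monomials of h and x are inverse to those with the opposite exponents. -/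
theorem iota_bracket {v : Polynomial k} (f g : B v) :
    iota v (bracket f g) = torusBracket (iota v f) (iota v g) := by
  obtain ⟨f, rfl⟩ := proj_surjective _ f
  obtain ⟨g, rfl⟩ := proj_surjective _ g
  rw [bracket_proj]
  set φ : MvPolynomial (Fin 3) k →ₐ[k] AddMonoidAlgebra k Expo := (iota v).comp (proj v) with hφ
  have hφ' : ∀ p, iota v (proj v p) = φ p := fun p => rfl
  rw [hφ', hφ', hφ']
  have h0 : φ (MvPolynomial.X 0) = T ex 1 := iota_x v
  have h1 : φ (MvPolynomial.X 1) = T (-ex) 1 * Polynomial.aeval (T eh 1) v := iota_y v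
  have h2 : φ (MvPolynomial.X 2) = T eh 1 := iota_h v
  have hd : φ (Polynomial.aeval (MvPolynomial.X 2) (Polynomial.derivative v)) =
      Polynomial.aeval (T eh 1) (Polynomial.derivative v) := by
    rw [← h2, ← Polynomial.aeval_algHom_apply]
  rw [torusBracket, derivation_mvPolynomial_aeval _ φ f, derivation_mvPolynomial_aeval _ φ g,
    derivation_mvPolynomial_aeval _ φ f, derivation_mvPolynomial_aeval _ φ g]
  simp only [polyBracket, map_sub, map_mul, h0, h1, h2, hd, Derivation.leibniz, euler_single,
    Derivation.map_aeval, smul_eq_mul]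
  have e1 : (T (-eh) 1 * T eh 1 : AddMonoidAlgebra k Expo) = 1 := by
    simp [AddMonoidAlgebra.single_mul_single, AddMonoidAlgebra.one_def]
  have e2 : (T ex 1 * T (-ex) 1 : AddMonoidAlgebra k Expo) = 1 := by
    simp [AddMonoidAlgebra.single_mul_single, AddMonoidAlgebra.one_def]
  have e3 : ∀ (a : Expo) (m : ℤ), (T a ((m : k) * 1) : AddMonoidAlgebra k Expo)
      = (m : AddMonoidAlgebra k Expo) * T a 1 := by
    intro a m
    rw [mul_one, ← zsmul_eq_mul, AddMonoidAlgebra.smul_single, zsmul_eq_mul, mul_one]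
  simp only [e3, wt_ex, wt_eh, hdeg_ex, hdeg_eh, map_neg]
  push_cast
  generalize φ (MvPolynomial.pderiv 0 f) = f0
  generalize φ (MvPolynomial.pderiv 1 f) = f1
  generalize φ (MvPolynomial.pderiv 2 f) = f2
  generalize φ (MvPolynomial.pderiv 0 g) = g0
  generalize φ (MvPolynomial.pderiv 1 g) = g1
  generalize φ (MvPolynomial.pderiv 2 g) = g2
  linear_combination -(T ex 1 * (f2 * g0 - f0 * g2)
      - T (-ex) 1 * Polynomial.aeval (T eh 1) v * (f2 * g1 - f1 * g2)
      + T ex 1 * T (-ex) 1 * Polynomial.aeval (T eh 1) (Polynomial.derivative v)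
        * (f1 * g0 - f0 * g1)) * e1
    - Polynomial.aeval (T eh 1) (Polynomial.derivative v) * (f1 * g0 - f0 * g1) * e2

end Embedding

/-! ### The monomial basis and the cone of leading exponents -/

section Monomials

variable {k : Type*} [Field k]

/-- The monomials `x ^ i h ^ j` (`i ≥ 0`) and `y ^ (-i) h ^ j` (`i < 0`), a basis of `B(v)`. -/
noncomputable def mon (v : Polynomial k) (p : ℤ × ℕ) : B v :=
  x v ^ p.1.toNat * y v ^ (-p.1).toNat * h v ^ p.2

/-- The degree in `h` of a monomial when `y` is replaced by `v(h) / x`. -/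
def top (v : Polynomial k) (p : ℤ × ℕ) : ℕ := p.2 + v.natDegree * (-p.1).toNat

theorem h_mul_mon (v : Polynomial k) (i : ℤ) (j : ℕ) : h v * mon v (i, j) = mon v (i, j + 1) := by
  simp only [mon]; ring

theorem aeval_h_mul_mon (v P : Polynomial k) (i : ℤ) (j : ℕ) :
    Polynomial.aeval (h v) P * mon v (i, j)
      = ∑ l ∈ Finset.range (P.natDegree + 1), P.coeff l • mon v (i, j + l) := by
  rw [Polynomial.aeval_eq_sum_range, Finset.sum_mul]
  refine Finset.sum_congr rfl fun l _ => ?_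
  rw [smul_mul_assoc]
  simp only [mon]
  ring_nf

theorem x_mul_mon_of_nonneg (v : Polynomial k) {i : ℤ} (hi : 0 ≤ i) (j : ℕ) :
    x v * mon v (i, j) = mon v (i + 1, j) := by
  obtain ⟨a, rfl⟩ := Int.eq_ofNat_of_zero_le hi
  have e1 : (-(a : ℤ)).toNat = 0 := by omega
  have e2 : (-((a : ℤ) + 1)).toNat = 0 := by omega
  have e3 : ((a : ℤ) + 1).toNat = a + 1 := by omega
  simp only [mon, e1, e2, e3, Int.toNat_natCast]
  ring

theorem x_mul_mon_of_neg (v : Polynomial k) {i : ℤ} (hi : i < 0) (j : ℕ) :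
    x v * mon v (i, j) = Polynomial.aeval (h v) v * mon v (i + 1, j) := by
  have e1 : i.toNat = 0 := by omega
  have e2 : (i + 1).toNat = 0 := by omega
  have e3 : (-i).toNat = (-(i + 1)).toNat + 1 := by omega
  simp only [mon, e1, e2, e3, ← x_mul_y]
  ring

theorem y_mul_mon_of_nonpos (v : Polynomial k) {i : ℤ} (hi : i ≤ 0) (j : ℕ) :
    y v * mon v (i, j) = mon v (i - 1, j) := by
  have e1 : i.toNat = 0 := by omega
  have e2 : (i - 1).toNat = 0 := by omega
  have e3 : (-(i - 1)).toNat = (-i).toNat + 1 := by omega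
  simp only [mon, e1, e2, e3]
  ring

theorem y_mul_mon_of_pos (v : Polynomial k) {i : ℤ} (hi : 0 < i) (j : ℕ) :
    y v * mon v (i, j) = Polynomial.aeval (h v) v * mon v (i - 1, j) := by
  have e1 : (-i).toNat = 0 := by omega
  have e2 : (-(i - 1)).toNat = 0 := by omega
  have e3 : i.toNat = (i - 1).toNat + 1 := by omega
  simp only [mon, e1, e2, e3, ← x_mul_y]
  ring

theorem span_mon (v : Polynomial k) : Submodule.span k (Set.range (mon v)) = ⊤ := by
  set S := Submodule.span k (Set.range (mon v)) with hS
  have hm : ∀ p, mon v p ∈ S := fun p => Submodule.subset_span ⟨p, rfl⟩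
  have hv : ∀ i j, Polynomial.aeval (h v) v * mon v (i, j) ∈ S := fun i j => by
    rw [aeval_h_mul_mon]
    exact Submodule.sum_mem _ fun l _ => S.smul_mem _ (hm _)
  have key : ∀ a : B v, (∀ i j, a * mon v (i, j) ∈ S) → ∀ b ∈ S, a * b ∈ S := by
    intro a ha b hb
    induction hb using Submodule.span_induction with
    | mem b hb => obtain ⟨⟨i, j⟩, rfl⟩ := hb; exact ha i j
    | zero => rw [mul_zero]; exact S.zero_mem
    | add b c _ _ hb hc => rw [mul_add]; exact S.add_mem hb hc
    | smul r b _ hb => rw [mul_smul_comm]; exact S.smul_mem r hb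
  have hx := key (x v) fun i j => by
    rcases le_or_gt 0 i with hi | hi
    · rw [x_mul_mon_of_nonneg v hi]; exact hm _
    · rw [x_mul_mon_of_neg v hi]; exact hv _ _
  have hy := key (y v) fun i j => by
    rcases le_or_gt i 0 with hi | hi
    · rw [y_mul_mon_of_nonpos v hi]; exact hm _
    · rw [y_mul_mon_of_pos v hi]; exact hv _ _
  have hh := key (h v) fun i j => by rw [h_mul_mon]; exact hm _
  rw [eq_top_iff]
  rintro b -
  obtain ⟨q, rfl⟩ := proj_surjective _ b
  induction q using MvPolynomial.induction_on with
  | C a =>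
    rw [show (MvPolynomial.C a : MvPolynomial (Fin 3) k) = algebraMap k _ a from rfl,
      AlgHom.commutes, Algebra.algebraMap_eq_smul_one]
    refine S.smul_mem a ?_
    simpa [mon] using hm (0, 0)
  | add p q hp hq => rw [map_add]; exact S.add_mem hp hq
  | mul_X p i hp =>
    rw [map_mul, mul_comm]
    fin_cases i
    · exact hx _ hp
    · exact hy _ hp
    · exact hh _ hp

theorem exists_eq_linearCombination {v : Polynomial k} (b : B v) :
    ∃ f : ℤ × ℕ →₀ k, b = ∑ p ∈ f.support, f p • mon v p := by
  have hb : b ∈ Submodule.span k (Set.range (mon v)) := by rw [span_mon]; trivial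
  obtain ⟨f, hf⟩ := Finsupp.mem_span_range_iff_exists_finsupp.mp hb
  exact ⟨f, hf.symm⟩

/-- Because of `hsum` a factor y behaves like h^n/x also on the level of exponents, so one formula
covers both kinds of monomials. It is used for `iota` itself and for `iota` after an automorphism.
-/
theorem lead_map_mon {v : Polynomial k} (θ : B v →ₐ[k] AddMonoidAlgebra k Expo)
    {eX eY eH : Expo} {α η β : k} (hX : Lead (θ (x v)) eX α) (hY : Lead (θ (y v)) eY η)
    (hH : Lead (θ (h v)) eH β) (hsum : eX + eY = v.natDegree • eH) (p : ℤ × ℕ) :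
    Lead (θ (mon v p)) (p.1 • eX + top v p • eH)
      (α ^ p.1.toNat * η ^ (-p.1).toNat * β ^ p.2) := by
  rw [mon, map_mul, map_mul, map_pow, map_pow, map_pow]
  refine (((hX.pow _).mul (hY.pow _)).mul (hH.pow _)).congr rfl ?_ rfl
  have hi : p.1 = (p.1.toNat : ℤ) - ((-p.1).toNat : ℤ) := by omega
  have key : ∀ χ : Expo →+ ℤ, χ (p.1.toNat • eX + (-p.1).toNat • eY + p.2 • eH)
      = χ (p.1 • eX + top v p • eH) := by
    intro χ
    have hs := congrArg χ hsum
    simp only [map_add, map_nsmul, map_zsmul, nsmul_eq_mul, zsmul_eq_mul, Int.cast_id] at hs ⊢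
    rw [top]; push_cast
    linear_combination ((-p.1).toNat : ℤ) * hs - χ eX * hi
  exact Expo.ext (key wt) (key hdeg)

/-- The exponent of a monomial. -/
def expo (v : Polynomial k) (p : ℤ × ℕ) : Expo := p.1 • ex + top v p • eh

@[simp] theorem wt_expo (v : Polynomial k) (p : ℤ × ℕ) : wt (expo v p) = p.1 + 3 * top v p := by
  rw [expo, map_add, map_zsmul, map_nsmul]; simp; ring

@[simp] theorem hdeg_expo (v : Polynomial k) (p : ℤ × ℕ) : hdeg (expo v p) = top v p := by
  rw [expo, map_add, map_zsmul, map_nsmul]; simp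

theorem expo_injective (v : Polynomial k) : Function.Injective (expo v) := by
  rintro ⟨i, j⟩ ⟨i', j'⟩ e
  have h1 := congrArg wt e
  have h2 := congrArg hdeg e
  simp only [wt_expo, hdeg_expo, Nat.cast_inj] at h1 h2
  rw [h2] at h1
  have hi : i = i' := by simpa using h1
  subst hi
  simp only [top] at h2
  simpa using h2

theorem natDegree_mul_add_top_nonneg (v : Polynomial k) (p : ℤ × ℕ) :
    0 ≤ v.natDegree * p.1 + top v p := by
  rw [top]; push_cast
  have : -p.1 ≤ ((-p.1).toNat : ℤ) := Int.self_le_toNat _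
  nlinarith [(Nat.zero_le p.2 : (0 : ℕ) ≤ p.2), (v.natDegree : ℤ) * p.1]

theorem lead_iota_mon (v : Polynomial k) (p : ℤ × ℕ) :
    Lead (iota v (mon v p)) (expo v p) (v.leadingCoeff ^ (-p.1).toNat) :=
  (lead_map_mon (iota v) (lead_iota_x v) (lead_iota_y v) (lead_iota_h v) (by abel) p).congr
    rfl rfl (by simp)

/-- Distinct monomials have distinct exponents, so the heaviest one cannot be cancelled. This yields
injectivity of `iota` and the restriction of leading exponents to the image of `expo`. -/
theorem exists_lead_linearCombination {v : Polynomial k} {f : ℤ × ℕ →₀ k}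
    (hf : f ≠ 0) : ∃ p ∈ f.support, (∀ q ∈ f.support, expo v q ≤ expo v p) ∧
      Lead (iota v (∑ q ∈ f.support, f q • mon v q)) (expo v p)
        (f p * v.leadingCoeff ^ (-p.1).toNat) := by
  obtain ⟨p, hp, hmax⟩ := Finset.exists_max_image f.support (expo v)
    (Finsupp.support_nonempty_iff.mpr hf)
  refine ⟨p, hp, hmax, ?_⟩
  rw [map_sum]
  refine (Lead.sum (e := expo v p) f.support _ (fun q => if q = p then
    f p * v.leadingCoeff ^ (-p.1).toNat else 0) fun q hq => ?_).congr rfl rfl (by simp_all)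
  rw [map_smul]
  have hl := (lead_iota_mon v q).smul (f q)
  split_ifs with hqp
  · subst hqp; exact hl
  · exact hl.of_lt (lt_of_le_of_ne (hmax q hq) fun e => hqp (expo_injective v e))

theorem expo_le_of_lead {v : Polynomial k} (hv : v ≠ 0) {f : ℤ × ℕ →₀ k} {e : Expo} {c : k}
    (hl : Lead (iota v (∑ q ∈ f.support, f q • mon v q)) e c) :
    ∀ q ∈ f.support, expo v q ≤ e := by
  intro q hq
  have hf : f ≠ 0 := fun h0 => by simp [h0] at hq
  obtain ⟨p, hp, hmax, hp'⟩ := exists_lead_linearCombination (v := v) hf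
  refine (hmax q hq).trans (hp'.le hl (mul_ne_zero (Finsupp.mem_support_iff.mp hp) ?_))
  exact pow_ne_zero _ (Polynomial.leadingCoeff_ne_zero.mpr hv)

theorem iota_injective {v : Polynomial k} (hv : v ≠ 0) : Function.Injective (iota v) := by
  rw [injective_iff_map_eq_zero]
  intro b hb
  obtain ⟨f, rfl⟩ := exists_eq_linearCombination b
  by_contra hne
  have hf : f ≠ 0 := fun h0 => hne (by simp [h0])
  obtain ⟨p, hp, -, hp'⟩ := exists_lead_linearCombination (v := v) hf
  refine hp'.ne_zero (mul_ne_zero (Finsupp.mem_support_iff.mp hp) ?_) hb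
  exact pow_ne_zero _ (Polynomial.leadingCoeff_ne_zero.mpr hv)

theorem exists_expo_eq {v : Polynomial k} (hv : v ≠ 0) {b : B v} {e : Expo} {c : k}
    (hl : Lead (iota v b) e c) (hc : c ≠ 0) : ∃ p, e = expo v p := by
  obtain ⟨f, rfl⟩ := exists_eq_linearCombination b
  have hf : f ≠ 0 := fun h0 => hl.ne_zero hc (by simp [h0])
  obtain ⟨p, hp, -, hp'⟩ := exists_lead_linearCombination (v := v) hf
  refine ⟨p, hl.unique hp' hc (mul_ne_zero (Finsupp.mem_support_iff.mp hp) ?_)⟩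
  exact pow_ne_zero _ (Polynomial.leadingCoeff_ne_zero.mpr hv)

theorem exists_lead_iota {v : Polynomial k} (hv : v ≠ 0) {b : B v} (hb : b ≠ 0) :
    ∃ e c, c ≠ 0 ∧ Lead (iota v b) e c :=
  exists_lead ((map_ne_zero_iff _ (iota_injective hv)).mpr hb)

theorem mul_left_cancel_of_ne_zero {v : Polynomial k} (hv : v ≠ 0) {a b c : B v} (ha : a ≠ 0)
    (e : a * b = a * c) : b = c := by
  refine iota_injective hv (mul_left_cancel₀ ((map_ne_zero_iff _ (iota_injective hv)).mpr ha) ?_)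
  rw [← map_mul, ← map_mul, e]

theorem x_ne_zero (v : Polynomial k) : x v ≠ 0 := fun e => by
  have := lead_iota_x v
  rw [e, map_zero] at this
  exact this.ne_zero one_ne_zero rfl

/-- Leading exponents lie in the cone spanned by those of x and y; the first and third inequalities
describe its two sides. -/
theorem wt_nonneg_of_lead {v : Polynomial k} (hv : 1 ≤ v.natDegree) {b : B v} {e : Expo} {c : k}
    (hl : Lead (iota v b) e c) (hc : c ≠ 0) :
    0 ≤ hdeg e ∧ 2 * hdeg e ≤ wt e ∧ 0 ≤ v.natDegree * (wt e - 3 * hdeg e) + hdeg e := by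
  obtain ⟨p, rfl⟩ := exists_expo_eq (by rintro rfl; simp at hv) hl hc
  have h1 := natDegree_mul_add_top_nonneg v p
  simp only [wt_expo, hdeg_expo, add_sub_cancel_right]
  refine ⟨by positivity, ?_, h1⟩
  by_contra! hlt
  have hv' : (1 : ℤ) ≤ v.natDegree := by exact_mod_cast hv
  have : p.1 + top v p ≤ -1 := by omega
  nlinarith [(Int.natCast_nonneg (top v p))]

end Monomials

/-! ### Evaluation at x = t and a degree bound for the inverse automorphism -/

section Evaluation

variable {k : Type*} [Field k]

open Polynomial

/-- The evaluation `x ↦ t`, `y ↦ v(h) / t` with values in `k[h]`. -/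
noncomputable def ev (v : k[X]) (t : k) (ht : t ≠ 0) : B v →ₐ[k] k[X] :=
  lift v (C t) (C t⁻¹ * v) X (by
    rw [← mul_assoc, ← C_mul, mul_inv_cancel₀ ht, C_1, one_mul, aeval_X_left_apply])

theorem ev_x (v : k[X]) (t : k) (ht : t ≠ 0) : ev v t ht (x v) = C t := lift_x v _ _ _ _
theorem ev_y (v : k[X]) (t : k) (ht : t ≠ 0) : ev v t ht (y v) = C t⁻¹ * v := lift_y v _ _ _ _
theorem ev_h (v : k[X]) (t : k) (ht : t ≠ 0) : ev v t ht (h v) = X := lift_h v _ _ _ _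

theorem ev_surjective (v : k[X]) (t : k) (ht : t ≠ 0) : Function.Surjective (ev v t ht) := by
  intro q
  refine ⟨aeval (h v) q, ?_⟩
  rw [← aeval_algHom_apply, ev_h, aeval_X_left_apply]

theorem ev_mon (v : k[X]) (t : k) (ht : t ≠ 0) (p : ℤ × ℕ) :
    ev v t ht (mon v p) = C (t ^ p.1) * (v ^ (-p.1).toNat * X ^ p.2) := by
  rw [mon, map_mul, map_mul, map_pow, map_pow, map_pow, ev_x, ev_y, ev_h, mul_pow, ← C_pow,
    ← C_pow]
  have hi : p.1 = (p.1.toNat : ℤ) - ((-p.1).toNat : ℤ) := by omega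
  have : t ^ p.1 = t ^ p.1.toNat * t⁻¹ ^ (-p.1).toNat := by
    conv_lhs => rw [hi]
    rw [zpow_sub₀ ht, zpow_natCast, zpow_natCast, inv_pow, div_eq_mul_inv]
  rw [this, C_mul]
  ring

theorem natDegree_pow_mul_X_pow_le (v : k[X]) (p : ℤ × ℕ) :
    (v ^ (-p.1).toNat * X ^ p.2).natDegree ≤ top v p := by
  refine natDegree_mul_le.trans ?_
  rw [natDegree_X_pow, top, add_comm, mul_comm v.natDegree]
  exact Nat.add_le_add_left natDegree_pow_le _

theorem coeff_pow_mul_X_pow_top (v : k[X]) (p : ℤ × ℕ) :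
    (v ^ (-p.1).toNat * X ^ p.2).coeff (top v p) = v.leadingCoeff ^ (-p.1).toNat := by
  rw [top, add_comm, coeff_mul_X_pow, mul_comm, coeff_pow_mul_natDegree]

theorem natDegree_ev_le {v : k[X]} (t : k) (ht : t ≠ 0) (f : ℤ × ℕ →₀ k) {N : ℕ}
    (hN : ∀ p ∈ f.support, top v p ≤ N) :
    (ev v t ht (∑ p ∈ f.support, f p • mon v p)).natDegree ≤ N := by
  rw [map_sum]
  refine natDegree_sum_le_of_forall_le _ _ fun p hp => ?_
  rw [map_smul, ev_mon]
  refine (natDegree_smul_le _ _).trans ((natDegree_C_mul_le _ _).trans ?_)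
  exact (natDegree_pow_mul_X_pow_le v p).trans (hN p hp)

theorem coeff_ev {v : k[X]} (t : k) (ht : t ≠ 0) (f : ℤ × ℕ →₀ k) {N : ℕ}
    (hN : ∀ p ∈ f.support, top v p ≤ N) :
    (ev v t ht (∑ p ∈ f.support, f p • mon v p)).coeff N =
      ∑ p ∈ f.support with top v p = N, f p * v.leadingCoeff ^ (-p.1).toNat * t ^ p.1 := by
  rw [map_sum, finsetSum_coeff, Finset.sum_filter]
  refine Finset.sum_congr rfl fun p hp => ?_
  rw [map_smul, ev_mon, coeff_smul, coeff_C_mul, smul_eq_mul]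
  split_ifs with hpN
  · subst hpN
    rw [coeff_pow_mul_X_pow_top]
    ring
  · rw [coeff_eq_zero_of_natDegree_lt, mul_zero, mul_zero]
    exact (natDegree_pow_mul_X_pow_le v p).trans_lt (lt_of_le_of_ne (hN p hp) hpN)

/-- As a function of t the coefficient at h^N is a Laurent polynomial whose terms have pairwise
different powers of t, since p.1 and `top v p` determine p. After multiplication by t^M it is a
nonzero polynomial, and t is taken away from its roots, from 0 and from c. -/
theorem exists_coeff_ev_ne_zero [Infinite k] {v : k[X]} (hv : v ≠ 0) (f : ℤ × ℕ →₀ k) {N : ℕ}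
    (hN : ∀ p ∈ f.support, top v p ≤ N) {p₀ : ℤ × ℕ} (hp₀ : p₀ ∈ f.support) (hp₀N : top v p₀ = N)
    (c : k) : ∃ (t : k) (ht : t ≠ 0), t ≠ c ∧
      (ev v t ht (∑ p ∈ f.support, f p • mon v p)).coeff N ≠ 0 := by
  set M : ℕ := f.support.sup fun p => (-p.1).toNat with hM
  have hMle : ∀ p ∈ f.support, (-p.1).toNat ≤ M := fun p hp =>
    Finset.le_sup (f := fun p : ℤ × ℕ => (-p.1).toNat) hp
  set Q : k[X] := ∑ p ∈ f.support with top v p = N,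
    C (f p * v.leadingCoeff ^ (-p.1).toNat) * X ^ (M + p.1).toNat with hQ
  have hQ0 : Q ≠ 0 := by
    intro h0
    have hc := congrArg (fun P => coeff P (M + p₀.1).toNat) h0
    simp only [hQ, finsetSum_coeff, coeff_C_mul, coeff_X_pow, coeff_zero] at hc
    rw [Finset.sum_eq_single p₀] at hc
    · simp only [if_true, mul_one] at hc
      exact mul_ne_zero (Finsupp.mem_support_iff.mp hp₀)
        (pow_ne_zero _ (leadingCoeff_ne_zero.mpr hv)) hc
    · intro p hp hne
      rw [if_neg, mul_zero]
      intro heq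
      obtain ⟨hp, hpN⟩ := Finset.mem_filter.mp hp
      have h1 := hMle p hp
      have h2 := hMle p₀ hp₀
      have h3 : p.1 = p₀.1 := by omega
      refine hne (Prod.ext h3 ?_)
      have h4 := hpN.trans hp₀N.symm
      rw [top, top, h3] at h4
      omega
    · intro hn
      exact absurd (Finset.mem_filter.mpr ⟨hp₀, hp₀N⟩) hn
  classical
  have hP : Q * X * (X - C c) ≠ 0 := mul_ne_zero (mul_ne_zero hQ0 X_ne_zero) (X_sub_C_ne_zero c)
  obtain ⟨t, ht⟩ := Infinite.exists_notMem_finset (Q * X * (X - C c)).roots.toFinset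
  rw [Multiset.mem_toFinset, mem_roots hP, IsRoot.def, eval_mul, eval_mul, eval_X, eval_sub,
    eval_X, eval_C, mul_eq_zero, mul_eq_zero, not_or, not_or, sub_eq_zero] at ht
  refine ⟨t, ht.1.2, ht.2, fun h0 => ht.1.1 ?_⟩
  rw [coeff_ev t ht.1.2 f hN] at h0
  have : Q.eval t = t ^ M * ∑ p ∈ f.support with top v p = N,
      f p * v.leadingCoeff ^ (-p.1).toNat * t ^ p.1 := by
    rw [hQ, eval_finsetSum, Finset.mul_sum]
    refine Finset.sum_congr rfl fun p hp => ?_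
    have h1 := hMle p (Finset.mem_filter.mp hp).1
    rw [eval_mul, eval_C, eval_pow, eval_X, ← zpow_natCast t (M + p.1).toNat,
      Int.toNat_of_nonneg (by omega), zpow_add₀ ht.1.2, zpow_natCast]
    ring
  rw [this, h0, mul_zero]

/-- An intersection count: φ carries the ideal (x - t, φ⁻¹(x) - 1) to (φ(x) - t, x - 1). The first
quotient is k[h] modulo a polynomial of degree N for suitable t, the second is k[h] modulo
φ(x)|_{x=1} - t. Comparing dimensions bounds the inverse by φ, with no condition on the
characteristic. -/
theorem top_le_natDegree_ev [Infinite k] {v : k[X]} (hv : v ≠ 0) (φ : B v ≃ₐ[k] B v)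
    (f : ℤ × ℕ →₀ k) (hf : φ.symm (x v) = ∑ p ∈ f.support, f p • mon v p) {p : ℤ × ℕ}
    (hp : p ∈ f.support) : top v p ≤ (ev v 1 one_ne_zero (φ (x v))).natDegree := by
  obtain ⟨p₀, hp₀, hmax⟩ := Finset.exists_max_image f.support (top v) ⟨p, hp⟩
  refine (hmax p hp).trans ?_
  set N := top v p₀ with hN
  rcases Nat.eq_zero_or_pos N with h0 | hpos
  · omega
  set F := ev v 1 one_ne_zero (φ (x v)) with hF
  -- Avoiding the constant term of F ensures F - t ≠ 0 even if F is constant.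
  obtain ⟨t, ht, htc, hcoeff⟩ := exists_coeff_ev_ne_zero hv f hmax hp₀ rfl (F.coeff 0)
  rw [← hf] at hcoeff
  have hle := natDegree_ev_le t ht f hmax
  rw [← hf] at hle
  set G := ev v t ht (φ.symm (x v)) - C 1 with hG
  have hGdeg : G.natDegree = N := by
    rw [hG, natDegree_sub_C]
    exact le_antisymm hle (le_natDegree_of_ne_zero hcoeff)
  have hG0 : G ≠ 0 := fun h0 => by rw [h0, natDegree_zero] at hGdeg; omega
  have hFt : F - C t ≠ 0 := fun h0 => htc (by
    have := congrArg (fun P => coeff P 0) h0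
    simp only [coeff_sub, coeff_C_zero, coeff_zero] at this
    exact (sub_eq_zero.mp this).symm)
  obtain ⟨ψ, hψ⟩ : ∃ ψ : B v →ₐ[k] AdjoinRoot G,
      ∀ b, ψ b = AdjoinRoot.mk G (ev v t ht (φ.symm b)) :=
    ⟨((AdjoinRoot.mkₐ G).comp (ev v t ht)).comp φ.symm.toAlgHom, fun b => rfl⟩
  have hψsurj : Function.Surjective ψ := by
    intro a
    obtain ⟨q, rfl⟩ := AdjoinRoot.mk_surjective a
    obtain ⟨b, rfl⟩ := ev_surjective v t ht q
    exact ⟨φ b, by rw [hψ, AlgEquiv.symm_apply_apply]⟩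
  have hψx : ψ (x v) = 1 := by
    rw [hψ, ← map_one (AdjoinRoot.mk G), AdjoinRoot.mk_eq_mk, ← C_1]
  have hψX : ψ (φ (x v)) = algebraMap k _ t := by
    rw [hψ, AlgEquiv.symm_apply_apply, ev_x]
    rfl
  -- Since ψ sends x to 1, it factors through the evaluation at x = 1.
  have hfac : ψ = (aeval (ψ (h v))).comp (ev v 1 one_ne_zero) := by
    apply algHom_ext
    · rw [AlgHom.comp_apply, ev_x, hψx, aeval_C, map_one]
    · rw [AlgHom.comp_apply, ev_y, inv_one, C_1, one_mul, aeval_algHom_apply, ← x_mul_y, map_mul,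
        hψx, one_mul]
    · rw [AlgHom.comp_apply, ev_h, aeval_X]
  have hroot : aeval (ψ (h v)) (F - C t) = 0 := by
    have := congrArg (fun θ => θ (φ (x v))) hfac
    simp only [AlgHom.comp_apply] at this
    rw [map_sub, hF, ← this, hψX, aeval_C, sub_self]
  let θ : AdjoinRoot (F - C t) →ₐ[k] AdjoinRoot G :=
    AdjoinRoot.liftAlgHom (F - C t) (Algebra.ofId k _) (ψ (h v)) hroot
  have hθ : Function.Surjective θ := by
    intro a
    obtain ⟨b, rfl⟩ := hψsurj a
    refine ⟨AdjoinRoot.mk _ (ev v 1 one_ne_zero b), ?_⟩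
    rw [hfac]
    simp [θ, AdjoinRoot.liftAlgHom, aeval_def]
  have : Module.Finite k (AdjoinRoot (F - C t)) := (AdjoinRoot.powerBasis hFt).finite
  have h1 := LinearMap.finrank_le_finrank_of_surjective (f := θ.toLinearMap) hθ
  rw [(AdjoinRoot.powerBasis hFt).finrank, (AdjoinRoot.powerBasis hG0).finrank,
    AdjoinRoot.powerBasis_dim, AdjoinRoot.powerBasis_dim, hGdeg, natDegree_sub_C] at h1
  exact h1

end Evaluation

open Polynomial

/-! ### Multiplicities of roots of polynomials with periodic exponents -/

section Multiplicity

variable {k : Type*} [Field k]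

/-- Here q = X^r q₁(X^b), and β is a simple root of X^b - β^b because b ≠ 0 in k. Hence the
multiplicity of β in q is that of β^b in q₁, which is at most deg q₁. -/
theorem mul_rootMultiplicity_le_natDegree {q : k[X]} (hq : q ≠ 0) {b r : ℕ} (hb : (b : k) ≠ 0)
    (hr : ∀ j, q.coeff j ≠ 0 → j % b = r) {β : k} (hβ : β ≠ 0) :
    b * q.rootMultiplicity β ≤ q.natDegree := by
  have hb0 : b ≠ 0 := by rintro rfl; simp at hb
  obtain ⟨q', hq'⟩ : X ^ r ∣ q := by
    rw [X_pow_dvd_iff]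
    intro j hj
    by_contra hne
    have := hr j hne
    have := Nat.mod_le j b
    omega
  have hq'0 : q' ≠ 0 := by rintro rfl; simp [hq'] at hq
  have hexp : expand k b (contract b q') = q' := by
    ext j
    rw [coeff_expand (Nat.pos_of_ne_zero hb0)]
    split_ifs with hj
    · rw [coeff_contract hb0, Nat.div_mul_cancel hj]
    · by_contra hne
      have h1 : q.coeff (j + r) ≠ 0 := by
        rw [hq', mul_comm, coeff_mul_X_pow]; exact fun h => hne h.symm
      have h2 := hr _ h1
      apply hj
      have h3 := Nat.div_add_mod (j + r) b
      rw [h2] at h3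
      exact ⟨(j + r) / b, by omega⟩
  set q₁ := contract b q' with hq₁
  have hq₁0 : q₁ ≠ 0 := by rintro h0; rw [h0, map_zero] at hexp; exact hq'0 hexp.symm
  obtain ⟨s, hs, hns⟩ := exists_eq_pow_rootMultiplicity_mul_and_not_dvd q₁ hq₁0 (β ^ b)
  set m := q₁.rootMultiplicity (β ^ b) with hm
  obtain ⟨S, hS⟩ : X - C β ∣ (X ^ b - C (β ^ b) : k[X]) := by
    rw [dvd_iff_isRoot]; simp
  have hSβ : S.eval β ≠ 0 := by
    have := congrArg (fun P => eval β (derivative P)) hS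
    simp only [derivative_sub, derivative_X_pow, derivative_C, derivative_mul, derivative_X,
      eval_sub, eval_mul, eval_add, eval_C, eval_X, eval_pow, sub_zero, sub_self,
      zero_mul, add_zero, one_mul] at this
    rw [← this]
    exact mul_ne_zero hb (pow_ne_zero _ hβ)
  have hsβ : (expand k b s).eval β ≠ 0 := by
    rw [expand_eval]
    exact fun h0 => hns (dvd_iff_isRoot.mpr h0)
  have hfac : q = (X - C β) ^ m * (X ^ r * S ^ m * expand k b s) := by
    rw [hq', ← hexp, hs, map_mul, map_pow, map_sub, expand_X, expand_C, hS, mul_pow]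
    ring
  have hne : (X ^ r * S ^ m * expand k b s).eval β ≠ 0 := by
    simp only [eval_mul, eval_pow, eval_X]
    exact mul_ne_zero (mul_ne_zero (pow_ne_zero _ hβ) (pow_ne_zero _ hSβ)) hsβ
  have hmult : q.rootMultiplicity β = m := by
    have h0 := hq
    rw [hfac] at h0
    rw [hfac, rootMultiplicity_mul h0, rootMultiplicity_X_sub_C_pow,
      rootMultiplicity_eq_zero hne, add_zero]
  rw [hmult, hq', natDegree_mul (pow_ne_zero _ X_ne_zero) hq'0, ← hexp, natDegree_expand, hs,
    natDegree_mul (pow_ne_zero _ (X_sub_C_ne_zero _)) (by rintro rfl; simp at hns),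
    natDegree_pow (X - C (β ^ b)), natDegree_X_sub_C]
  nlinarith [Nat.zero_le (s.natDegree * b), Nat.zero_le ((X ^ r : k[X]).natDegree)]

theorem eval_iterate_derivative_rootMultiplicity_ne_zero {q : k[X]} (hq : q ≠ 0) (β : k)
    (hl : ((q.rootMultiplicity β).factorial : k) ≠ 0) :
    (derivative^[q.rootMultiplicity β] q).eval β ≠ 0 := by
  rw [eval_iterate_derivative_rootMultiplicity, nsmul_eq_mul]
  exact mul_ne_zero hl (eval_divByMonic_pow_rootMultiplicity_ne_zero β hq)

theorem factorial_ne_zero_of_lt_char (p : ℕ) [CharP k p] [Fact p.Prime] {l : ℕ} (hl : l < p) :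
    (l.factorial : k) ≠ 0 := by
  rw [Ne, CharP.cast_eq_zero_iff k p, (Fact.out : p.Prime).dvd_factorial]
  omega

end Multiplicity

/-! ### The derivation ad x -/

section Adjoint

variable {k : Type*} [Field k] {v : k[X]}

theorem bracket_smul (c : k) (f g : B v) : bracket f (c • g) = c • bracket f g := by
  obtain ⟨f, rfl⟩ := proj_surjective _ f
  obtain ⟨g, rfl⟩ := proj_surjective _ g
  rw [← map_smul, bracket_proj, bracket_proj, ← map_smul]
  congr 1
  have hc : ∀ i, MvPolynomial.pderiv i (c • g) = MvPolynomial.C c * MvPolynomial.pderiv i g :=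
    fun i => by rw [Derivation.map_smul, MvPolynomial.smul_eq_C_mul]
  simp only [polyBracket, hc]
  rw [MvPolynomial.smul_eq_C_mul]
  ring

/-- The derivation `{f, ·}` of `B(v)`. -/
noncomputable def ad (f : B v) : Derivation k (B v) (B v) :=
  Derivation.mk' { toFun := bracket f, map_add' := bracket_add f,
                   map_smul' := fun c g => bracket_smul c f g } (by
    intro a b
    change bracket f (a * b) = a * bracket f b + b * bracket f a
    rw [bracket_mul]; ring)

theorem ad_apply (f g : B v) : ad f g = bracket f g := rfl

theorem ad_x_x : ad (x v) (x v) = 0 := by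
  rw [ad_apply]
  simp [x, bracket_proj, polyBracket, MvPolynomial.pderiv_X]

theorem ad_x_h : ad (x v) (h v) = - x v := by
  rw [ad_apply, bracket_swap, bracket_h_x]

theorem ad_x_pow_mul_aeval (s : ℕ) (P : k[X]) :
    ad (x v) (x v ^ s * aeval (h v) P) = - (x v ^ (s + 1) * aeval (h v) (derivative P)) := by
  rw [Derivation.leibniz, Derivation.leibniz_pow, ad_x_x, Derivation.map_aeval, ad_x_h]
  simp only [smul_eq_mul, smul_zero, mul_zero, add_zero]
  ring

/-- On elements x^s P(h), ad x is differentiation in h up to sign and a factor x; this is what turns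
multiplicity of a root into a number of brackets. -/
theorem iterate_ad_x_pow_mul_aeval (l s : ℕ) (P : k[X]) :
    (ad (x v))^[l] (x v ^ s * aeval (h v) P)
      = (-1) ^ l * (x v ^ (s + l) * aeval (h v) (derivative^[l] P)) := by
  induction l with
  | zero => simp
  | succ l ih =>
    rw [Function.iterate_succ_apply', ih, Function.iterate_succ_apply', Derivation.leibniz,
      ad_x_pow_mul_aeval, Derivation.leibniz_pow]
    simp only [map_neg, Derivation.map_one_eq_zero, smul_eq_mul, smul_zero, mul_zero,
      neg_zero, add_zero]
    ring

theorem iterate_derivation_sum {A : Type*} [CommRing A] [Algebra k A] (D : Derivation k A A)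
    (l : ℕ) {ι : Type*} (s : Finset ι) (F : ι → A) (c : ι → k) :
    D^[l] (∑ i ∈ s, c i • F i) = ∑ i ∈ s, c i • D^[l] (F i) := by
  induction l with
  | zero => rfl
  | succ l ih =>
    simp only [Function.iterate_succ_apply', ih, map_sum]
    exact Finset.sum_congr rfl fun i _ => D.map_smul _ _

theorem x_pow_mul_mon (M : ℕ) {p : ℤ × ℕ} (hM : (-p.1).toNat ≤ M) :
    x v ^ M * mon v p = x v ^ (M + p.1).toNat * aeval (h v) (v ^ (-p.1).toNat * X ^ p.2) := by
  have h1 : M + p.1.toNat = (M + p.1).toNat + (-p.1).toNat := by omega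
  rw [mon, map_mul, map_pow, map_pow, aeval_X, ← x_mul_y, mul_pow]
  calc _ = x v ^ (M + p.1.toNat) * (y v ^ (-p.1).toNat * h v ^ p.2) := by ring
    _ = _ := by rw [h1]; ring

end Adjoint

/-! ### Leading terms under iterated brackets with x -/

section Key

variable {k : Type*} [Field k] {v : k[X]}

/-- `φ` multiplies brackets by `ε`. -/
def IsPoissonUpTo (ε : k) (φ : B v ≃ₐ[k] B v) : Prop :=
  ∀ f g : B v, φ (bracket f g) = ε • bracket (φ f) (φ g)

theorem lead_smul_torusBracket {f g : AddMonoidAlgebra k Expo} {e e' : Expo} {c c' : k} (ε : k)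
    (hf : Lead f e c) (hg : Lead g e' c') :
    Lead (ε • torusBracket f g) (e + e' - eh) (ε * ((expoDet e e' : k) * (c * c'))) :=
  (hf.torusBracket hg).smul ε

/-- The upper estimate: each bracket with φ(x) moves the bound on the exponent by eX - `eh`, whether
or not the coefficient survives. -/
theorem exists_lead_iterate_ad {ε : k} {φ : B v ≃ₐ[k] B v} (hφ : IsPoissonUpTo ε φ) {eX e : Expo}
    {α c : k} (hX : Lead (iota v (φ (x v))) eX α) {b : B v} (hb : Lead (iota v (φ b)) e c) (l : ℕ) :
    ∃ c', Lead (iota v (φ ((ad (x v))^[l] b))) (e + l • (eX - eh)) c' := by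
  induction l with
  | zero => exact ⟨c, by simpa using hb⟩
  | succ l ih =>
    obtain ⟨c', hc'⟩ := ih
    refine ⟨_, (lead_smul_torusBracket ε hX hc').congr ?_ ?_ rfl⟩
    · rw [Function.iterate_succ_apply', ad_apply, hφ, map_smul, iota_bracket]
    · rw [succ_nsmul]; abel

/-- The exact term: the factor x^M removes negative powers of x, and the coefficient is, up to the
power of x, the l-th derivative of h^(top) evaluated at β. -/
theorem lead_iterate_ad_mon (φ : B v ≃ₐ[k] B v) {eX eH : Expo} {α β : k}
    (hX : Lead (iota v (φ (x v))) eX α) (hH : Lead (iota v (φ (h v))) eH β) (heH : 0 < eH)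
    (M l : ℕ) {p : ℤ × ℕ} (hM : (-p.1).toNat ≤ M) :
    Lead (iota v (φ ((ad (x v))^[l] (x v ^ M * mon v p))))
      (p.1 • eX + top v p • eH + ((M + l) • eX - l • eH))
      ((-1) ^ l * (α ^ ((M + p.1).toNat + l) * (((top v p).descFactorial l : k) *
        v.leadingCoeff ^ (-p.1).toNat * β ^ (top v p - l)))) := by
  rw [x_pow_mul_mon M hM, iterate_ad_x_pow_mul_aeval]
  set P : k[X] := v ^ (-p.1).toNat * X ^ p.2 with hP
  have hPdeg : P.natDegree ≤ top v p := natDegree_pow_mul_X_pow_le v p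
  have hPtop : P.coeff (top v p) = v.leadingCoeff ^ (-p.1).toNat := coeff_pow_mul_X_pow_top v p
  have hform : iota v (φ ((-1) ^ l * (x v ^ ((M + p.1).toNat + l) *
      aeval (h v) (derivative^[l] P)))) = (-1 : k) ^ l • (iota v (φ (x v)) ^ ((M + p.1).toNat + l) *
      aeval (iota v (φ (h v))) (derivative^[l] P)) := by
    rw [map_mul, map_mul, map_mul, map_mul, map_pow, map_pow, map_pow, map_pow, map_neg, map_neg,
      map_one, map_one, aeval_algHom_apply, Algebra.smul_def, map_pow, map_neg, map_one]
    congr 3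
    exact (aeval_algHom_apply φ.toAlgHom (h v) _).symm
  rw [hform]
  rcases le_or_gt l (top v p) with hl | hl
  · have h1 := ((hX.pow ((M + p.1).toNat + l)).mul (hH.aeval heH (derivative^[l] P)
      (N := top v p - l) ((natDegree_iterate_derivative P l).trans (by omega)))).smul ((-1) ^ l)
    refine h1.congr rfl ?_ ?_
    · have key : ∀ χ : Expo →+ ℤ, χ (((M + p.1).toNat + l) • eX + (top v p - l) • eH)
          = χ (p.1 • eX + top v p • eH + ((M + l) • eX - l • eH)) := by
        intro χ
        have hi : (((M + p.1).toNat : ℕ) : ℤ) = M + p.1 := Int.toNat_of_nonneg (by omega)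
        simp only [map_add, map_sub, map_nsmul, map_zsmul, nsmul_eq_mul, zsmul_eq_mul, Int.cast_id]
        rw [Nat.cast_sub hl]
        push_cast
        rw [Int.toNat_of_nonneg (by omega)]
        ring
      exact Expo.ext (key wt) (key hdeg)
    · rw [coeff_iterate_derivative, Nat.sub_add_cancel hl, hPtop, nsmul_eq_mul]
  · have h0 : derivative^[l] P = 0 := iterate_derivative_eq_zero (by omega)
    rw [h0, map_zero, mul_zero, smul_zero, Nat.descFactorial_of_lt hl]
    refine (Lead.zero _).congr rfl rfl ?_
    simp

end Key

/-! ### Divisibility of the weight of φ(h) by the weight of φ(x) -/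

section Divisibility

variable {k : Type*} [Field k] {v : k[X]}

/-- The integer inequalities that a failure of divisibility would imply are contradictory. -/
theorem false_of_weights {n a b b' c g c' i J l : ℤ} (hn : 1 ≤ n) (hb : 0 < b) (hab : b ≤ a)
    (hsum : b + a = n * c) (hc : 3 ≤ c) (hbg : b = g * b') (hcg : c = g * c')
    (hb' : 0 < b') (hndvd : ¬ b ∣ c) (hl : 0 ≤ l) (hlJ : b' * l ≤ J) (hnJ : 0 ≤ n * i + J) (hJ : 0 ≤ J)
    (hup : i * b + J * c ≤ 1 + l * (c - 3)) (hlow : l = 0 → 1 ≤ i * b + J * c) : False := by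
  have hb'2 : 2 ≤ b' := by
    by_contra! hlt
    have h1 : b' = 1 := by omega
    exact hndvd ⟨c', by rw [hbg, hcg, h1]; ring⟩
  have hb2 : 2 ≤ b := by
    by_contra! hlt
    have h1 : b = 1 := by omega
    exact hndvd (h1 ▸ one_dvd c)
  -- The weight is rewritten in the coordinates of the cone spanned by x and y, where both summands
  -- are nonnegative.
  have hid : n * (i * b + J * c) = b * (n * i + J) + a * J := by linear_combination (-J) * hsum
  have h1 : 0 ≤ b * (n * i + J) := mul_nonneg hb.le hnJ
  have h2 : n * (i * b + J * c) ≤ n + l * (b + a) - 3 * n * l := by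
    have h3 := mul_le_mul_of_nonneg_left hup (by omega : 0 ≤ n)
    calc _ ≤ _ := h3
      _ = _ := by linear_combination (-l) * hsum
  have h4 : a * (2 * l) ≤ a * J :=
    mul_le_mul_of_nonneg_left ((mul_le_mul_of_nonneg_right hb'2 hl).trans hlJ) (by omega)
  have h5 : l * b ≤ l * a := mul_le_mul_of_nonneg_left hab hl
  -- From 2al ≤ aJ ≤ n + l(a + b) - 3nl ≤ n + 2al - 3nl one gets 3nl ≤ n.
  have hl0 : l = 0 := by
    by_contra hne
    have : 1 ≤ l := by omega
    nlinarith
  subst hl0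
  have h6 := hlow rfl
  have h7 : i * b + J * c = 1 := by omega
  -- With l = 0 the weight is exactly 1, while a, b ≥ 2 and c ≥ 3. For J = 0 this makes b a divisor
  -- of 1; for i < 0 it gives J ≥ n, so n = b(ni + J) + aJ ≥ 2n.
  rcases hJ.eq_or_lt with hJ0 | hJpos
  · rw [← hJ0, zero_mul, add_zero] at h7
    have := Int.le_of_dvd one_pos ⟨i, by rw [← h7]; ring⟩ (a := b)
    omega
  · rcases le_or_gt 0 i with hi | hi
    · nlinarith [mul_nonneg hi hb.le]
    · have h8 : n ≤ J := by nlinarith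
      rw [h7] at hid
      nlinarith

/-- With g = φ⁻¹(x), the element (ad x)^l(x^M g) is estimated twice after φ: exactly, from the
heaviest part of g, and from above, from φ(x^M g) = φ(x)^M x. The result W ≤ `ex` + l(eH - `eh`)
contradicts non-divisibility. -/
theorem wt_dvd_wt_of_wt_le [Infinite k] (p : ℕ) [Fact p.Prime] [CharP k p]
    (hv : 1 ≤ v.natDegree) {ε : k} {φ : B v ≃ₐ[k] B v} (hφ : IsPoissonUpTo ε φ)
    {eX eY eH : Expo} {α η β : k} (hα : α ≠ 0) (hβ : β ≠ 0)
    (hX : Lead (iota v (φ (x v))) eX α) (hY : Lead (iota v (φ (y v))) eY η)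
    (hH : Lead (iota v (φ (h v))) eH β) (hsum : eX + eY = v.natDegree • eH)
    (hbpos : 0 < wt eX) (hab : wt eX ≤ wt eY) (hc : 3 ≤ wt eH) (hbp : wt eX < p)
    (hdeg : (ev v 1 one_ne_zero (φ (x v))).natDegree < p) :
    wt eX ∣ wt eH := by
  by_contra hndvd
  have hv0 : v ≠ 0 := by rintro rfl; simp at hv
  have heH : 0 < eH := Expo.lt_iff.mpr (Or.inl (by rw [map_zero]; omega))
  obtain ⟨f, hf⟩ := exists_eq_linearCombination (φ.symm (x v))
  have hfx : φ (∑ q ∈ f.support, f q • mon v q) = x v := by rw [← hf, AlgEquiv.apply_symm_apply]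
  have hf0 : f.support.Nonempty := by
    rw [Finset.nonempty_iff_ne_empty]
    intro h0
    rw [h0, Finset.sum_empty, map_zero] at hfx
    exact x_ne_zero v hfx.symm
  set Λ : ℤ × ℕ → Expo := fun q => q.1 • eX + top v q • eH with hΛ
  obtain ⟨q₀, hq₀, hmax⟩ := Finset.exists_max_image f.support Λ hf0
  set W := Λ q₀ with hW
  set M : ℕ := f.support.sup fun q => (-q.1).toNat with hM
  have hMle : ∀ q ∈ f.support, (-q.1).toNat ≤ M := fun q hq =>
    Finset.le_sup (f := fun q : ℤ × ℕ => (-q.1).toNat) hq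
  set a : ℤ × ℕ → k := fun q => f q * v.leadingCoeff ^ (-q.1).toNat * α ^ (M + q.1).toNat with ha
  have ha0 : ∀ q ∈ f.support, a q ≠ 0 := fun q hq =>
    mul_ne_zero (mul_ne_zero (Finsupp.mem_support_iff.mp hq)
      (pow_ne_zero _ (leadingCoeff_ne_zero.mpr hv0))) (pow_ne_zero _ hα)
  -- The coefficient of φ(x^M g) at the expected top exponent W + M eX is Q(β), which may vanish.
  set Q : k[X] := ∑ q ∈ f.support with Λ q = W, C (a q) * X ^ top v q with hQ
  have hQcoeff : ∀ j, Q.coeff j ≠ 0 → ∃ q ∈ f.support, Λ q = W ∧ top v q = j := by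
    intro j hj
    by_contra! hne
    apply hj
    rw [hQ, finsetSum_coeff]
    refine Finset.sum_eq_zero fun q hq => ?_
    obtain ⟨h1, h2⟩ := Finset.mem_filter.mp hq
    rw [coeff_C_mul, coeff_X_pow, if_neg (Ne.symm (hne q h1 h2)), mul_zero]
  have hQ0 : Q ≠ 0 := by
    intro h0
    have hcf := congrArg (fun P => coeff P (top v q₀)) h0
    simp only [hQ, finsetSum_coeff, coeff_C_mul, coeff_X_pow, coeff_zero] at hcf
    rw [Finset.sum_eq_single q₀] at hcf
    · rw [if_pos rfl, mul_one] at hcf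
      exact ha0 q₀ hq₀ hcf
    · intro q hq hne
      rw [if_neg, mul_zero]
      intro htop
      have h2 := (Finset.mem_filter.mp hq).2
      have h3 := congrArg wt h2
      simp only [hΛ, hW, map_add, map_nsmul, map_zsmul, ← htop, add_left_inj, smul_eq_mul] at h3
      have h4 : q.1 = q₀.1 := mul_right_cancel₀ hbpos.ne' h3
      refine hne (Prod.ext h4 ?_)
      rw [top, top, h4] at htop
      omega
    · intro hn
      exact absurd (Finset.mem_filter.mpr ⟨hq₀, hW.symm⟩) hn
  -- the common period of the exponents occurring in `Q`
  obtain ⟨g, b', c', hgpos, hcop, hbg, hcg⟩ := Int.exists_gcd_one' (m := wt eX) (n := wt eH)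
    (by rw [Int.gcd_pos_iff]; left; exact hbpos.ne')
  have hb'pos : 0 < b' := by
    by_contra! h0
    have : (0 : ℤ) < g := by exact_mod_cast hgpos
    nlinarith
  lift b' to ℕ using hb'pos.le
  have hb'le : (b' : ℤ) ≤ wt eX := by
    rw [hbg]
    have : (1 : ℤ) ≤ g := by exact_mod_cast hgpos
    nlinarith
  have hb'k : (b' : k) ≠ 0 := by
    rw [Ne, CharP.cast_eq_zero_iff k p]
    intro hdvd
    have := Nat.le_of_dvd (by exact_mod_cast hb'pos) hdvd
    omega
  -- All terms of Q have the same weight i wt(eX) + j wt(eH), which fixes j modulo wt(eX)/gcd.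
  have hmod : ∀ j, Q.coeff j ≠ 0 → j % b' = top v q₀ % b' := by
    intro j hj
    obtain ⟨q, -, hqW, rfl⟩ := hQcoeff j hj
    have h3 := congrArg wt hqW
    simp only [hΛ, hW, map_add, map_nsmul, map_zsmul, smul_eq_mul, nsmul_eq_mul] at h3
    have h4 : ((top v q : ℤ) - top v q₀) * c' = (q₀.1 - q.1) * b' := by
      have hg0 : (g : ℤ) ≠ 0 := by exact_mod_cast hgpos.ne'
      apply mul_right_cancel₀ hg0
      rw [hbg, hcg] at h3
      linear_combination h3
    have h5 : (b' : ℤ) ∣ (top v q : ℤ) - top v q₀ := by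
      have hco : IsCoprime (b' : ℤ) c' := Int.isCoprime_iff_gcd_eq_one.mpr hcop
      exact hco.dvd_of_dvd_mul_right ⟨q₀.1 - q.1, by rw [h4]; ring⟩
    exact ((Nat.modEq_iff_dvd.mpr h5).symm)
  set l := Q.rootMultiplicity β with hl
  have hlQ : b' * l ≤ Q.natDegree := mul_rootMultiplicity_le_natDegree hQ0 hb'k hmod hβ
  obtain ⟨q₁, hq₁, hq₁W, hq₁top⟩ := hQcoeff Q.natDegree (leadingCoeff_ne_zero.mpr hQ0)
  -- l ≤ deg Q, and deg Q is bounded by the degree of φ(x) at x = 1 through the intersection count.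
  have hlp : l < p := by
    have h1 := top_le_natDegree_ev hv0 φ f hf hq₁
    have h2 : 1 ≤ b' := by exact_mod_cast hb'pos
    nlinarith
  have hroot : (derivative^[l] Q).eval β ≠ 0 :=
    eval_iterate_derivative_rootMultiplicity_ne_zero hQ0 β (factorial_ne_zero_of_lt_char p hlp)
  -- the coefficient of `(ad x)^l (x^M g)` at the expected exponent
  have hlow : Lead (iota v (φ ((ad (x v))^[l] (∑ q ∈ f.support, f q • (x v ^ M * mon v q)))))
      (W + ((M + l) • eX - l • eH)) ((-1) ^ l * α ^ l * (derivative^[l] Q).eval β) := by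
    rw [iterate_derivation_sum, map_sum, map_sum]
    refine (Lead.sum (e := W + ((M + l) • eX - l • eH)) f.support _ (fun q => if Λ q = W then
      (-1) ^ l * α ^ l * (a q * ((top v q).descFactorial l * β ^ (top v q - l))) else 0)
      fun q hq => ?_).congr rfl rfl ?_
    · have h1 := (lead_iterate_ad_mon φ hX hH heH M l (hMle q hq)).smul (f q)
      rw [map_smul, map_smul]
      split_ifs with hqW
      · refine h1.congr rfl (by rw [← hqW]) ?_
        simp only [ha]
        ring
      · exact h1.of_lt (add_lt_add_left (lt_of_le_of_ne (hmax q hq) hqW) _)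
    · rw [← Finset.sum_filter, ← Finset.mul_sum, hQ, iterate_derivative_sum, eval_finsetSum]
      congr 1
      refine Finset.sum_congr rfl fun q _ => ?_
      rw [iterate_derivative_C_mul, iterate_derivative_X_pow_eq_natCast_mul]
      simp
  have hxg : φ (∑ q ∈ f.support, f q • (x v ^ M * mon v q)) = φ (x v) ^ M * x v := by
    simp_rw [← mul_smul_comm]
    rw [← Finset.mul_sum, map_mul, map_pow, hfx]
  have hlead : Lead (iota v (φ (∑ q ∈ f.support, f q • (x v ^ M * mon v q)))) (M • eX + ex)
      (α ^ M * 1) := by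
    rw [hxg, map_mul, map_pow]
    exact (hX.pow M).mul (lead_iota_x v)
  obtain ⟨c₁, hup⟩ := exists_lead_iterate_ad hφ hX hlead l
  have hle := hlow.le hup (mul_ne_zero (mul_ne_zero (pow_ne_zero _ (neg_ne_zero.mpr one_ne_zero))
    (pow_ne_zero _ hα)) hroot)
  -- W bounds every term of φ(g) = x; this supplies the lower bound needed when l = 0.
  have hleW : ex ≤ W := by
    obtain ⟨c₂, h1⟩ : ∃ c₂, Lead (iota v (φ (∑ q ∈ f.support, f q • mon v q))) W c₂ := by
      rw [map_sum, map_sum]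
      refine ⟨_, Lead.sum f.support _ (fun q => if Λ q = W then f q *
        (α ^ q.1.toNat * η ^ (-q.1).toNat * β ^ q.2) else 0) fun q hq => ?_⟩
      have h2 := (lead_map_mon ((iota v).comp φ.toAlgHom) hX hY hH hsum q).smul (f q)
      rw [map_smul, map_smul]
      split_ifs with hqW
      · exact h2.congr rfl hqW rfl
      · exact h2.of_lt (lt_of_le_of_ne (hmax q hq) hqW)
    rw [hfx] at h1
    exact (lead_iota_x v).le h1 one_ne_zero
  have hwtW : wt W = q₁.1 * wt eX + top v q₁ * wt eH := by
    rw [← hq₁W]; simp [hΛ]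
  have hwt := wt_mono hle
  have hwt' := wt_mono hleW
  have hs := congrArg wt hsum
  simp only [map_add, map_sub, map_nsmul, nsmul_eq_mul, wt_ex, wt_eh, hwtW] at hwt hwt' hs
  push_cast at hwt
  refine false_of_weights (n := v.natDegree) (a := wt eY) (b := wt eX) (b' := b') (c := wt eH)
    (g := g) (c' := c') (i := q₁.1) (J := top v q₁) (l := l) (by exact_mod_cast hv) hbpos hab hs hc
    (by rw [hbg]; ring) (by rw [hcg]; ring) hb'pos hndvd (by positivity) ?_
    (natDegree_mul_add_top_nonneg v q₁) (by positivity) (by linarith) (fun _ => hwt')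
  rw [hq₁top]; exact_mod_cast hlQ

end Divisibility

/-! ### Automorphisms scaling the bracket: the exchange of x and y, and shears -/

section Automorphisms

variable {k : Type*} [Field k] {v : k[X]}

theorem B_induction {P : B v → Prop} (hC : ∀ c : k, P (algebraMap k (B v) c))
    (hadd : ∀ a b, P a → P b → P (a + b)) (hmul : ∀ a b, P a → P b → P (a * b))
    (hx : P (x v)) (hy : P (y v)) (hh : P (h v)) (b : B v) : P b := by
  obtain ⟨q, rfl⟩ := proj_surjective _ b
  induction q using MvPolynomial.induction_on with
  | C a =>
    rw [show (MvPolynomial.C a : MvPolynomial (Fin 3) k) = algebraMap k _ a from rfl,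
      AlgHom.commutes]
    exact hC a
  | add p q hp hq => rw [map_add]; exact hadd _ _ hp hq
  | mul_X p i hp =>
    rw [map_mul]
    fin_cases i
    · exact hmul _ _ hp hx
    · exact hmul _ _ hp hy
    · exact hmul _ _ hp hh

theorem bracket_algebraMap (f : B v) (c : k) : bracket f (algebraMap k (B v) c) = 0 := by
  rw [← ad_apply, Derivation.map_algebraMap]

theorem bracket_self (f : B v) : bracket f f = 0 := by
  obtain ⟨f, rfl⟩ := proj_surjective _ f
  rw [bracket_proj, polyBracket]
  convert map_zero (proj v) using 2
  ring

theorem bracket_aeval_self (f : B v) (P : k[X]) : bracket f (aeval f P) = 0 := by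
  rw [← ad_apply, Derivation.map_aeval, ad_apply, bracket_self, smul_zero]

theorem isPoissonUpTo_of_generators {ε : k} {ψ : B v ≃ₐ[k] B v}
    (H : ∀ f ∈ ({x v, y v, h v} : Set (B v)), ∀ g ∈ ({x v, y v, h v} : Set (B v)),
      ψ (bracket f g) = ε • bracket (ψ f) (ψ g)) : IsPoissonUpTo ε ψ := by
  have step : ∀ f, (∀ g ∈ ({x v, y v, h v} : Set (B v)),
      ψ (bracket f g) = ε • bracket (ψ f) (ψ g)) →
      ∀ g, ψ (bracket f g) = ε • bracket (ψ f) (ψ g) := by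
    intro f hf g
    refine B_induction (P := fun g => ψ (bracket f g) = ε • bracket (ψ f) (ψ g)) ?_ ?_ ?_
      (hf _ (by simp)) (hf _ (by simp)) (hf _ (by simp)) g
    · intro c
      rw [AlgEquiv.commutes, bracket_algebraMap, bracket_algebraMap, map_zero, smul_zero]
    · intro a b ha hb
      rw [bracket_add, map_add, map_add, bracket_add, ha, hb, smul_add]
    · intro a b ha hb
      rw [bracket_mul, map_add, map_mul, map_mul, map_mul, bracket_mul, ha, hb, smul_add,
        smul_mul_assoc, mul_smul_comm]
  intro f g
  refine step f (fun g hg => ?_) g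
  rw [bracket_swap g f, map_neg, bracket_swap (ψ g), smul_neg]
  exact congrArg _ (step g (fun f hf => H g hg f hf) f)

/-- The brackets {h, y} and {x, y} follow from {h, x}: apply ad h and ad x to xy = v(h) and cancel
the factor x. -/
theorem isPoissonUpTo_of_bracket_h_x (hv : v ≠ 0) {ε δ : k} (hεδ : ε * δ = 1)
    {ψ : B v ≃ₐ[k] B v} (H : bracket (ψ (h v)) (ψ (x v)) = δ • ψ (x v)) : IsPoissonUpTo ε ψ := by
  have hx0 : ψ (x v) ≠ 0 := (map_ne_zero_iff _ ψ.injective).mpr (x_ne_zero v)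
  have hxy : ψ (x v) * ψ (y v) = aeval (ψ (h v)) v := by
    rw [← map_mul, x_mul_y]
    exact (aeval_algHom_apply ψ.toAlgHom (h v) v).symm
  have h1 : bracket (ψ (h v)) (ψ (y v)) = -(δ • ψ (y v)) := by
    have e := bracket_aeval_self (ψ (h v)) v
    rw [← hxy, bracket_mul, H] at e
    apply mul_left_cancel_of_ne_zero hv hx0
    rw [mul_neg, mul_smul_comm, ← smul_mul_assoc]
    linear_combination e
  have h2 : bracket (ψ (x v)) (ψ (y v)) = -(δ • ψ (aeval (h v) (derivative v))) := by
    have e : bracket (ψ (x v)) (aeval (ψ (h v)) v) =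
        aeval (ψ (h v)) (derivative v) * bracket (ψ (x v)) (ψ (h v)) := by
      rw [← ad_apply, Derivation.map_aeval, smul_eq_mul, ad_apply]
    rw [← hxy, bracket_mul, bracket_self, zero_mul, zero_add, bracket_swap (ψ (h v)), H] at e
    apply mul_left_cancel_of_ne_zero hv hx0
    rw [e, show ψ (aeval (h v) (derivative v)) = aeval (ψ (h v)) (derivative v) from
      (aeval_algHom_apply ψ.toAlgHom (h v) _).symm, mul_neg, mul_neg, mul_smul_comm,
      mul_smul_comm, mul_comm]
  apply isPoissonUpTo_of_generators
  have hεδ' : ∀ b : B v, ε • δ • b = b := fun b => by rw [smul_smul, hεδ, one_smul]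
  rintro f (rfl | rfl | rfl) g (rfl | rfl | rfl)
  · rw [bracket_self, bracket_self, map_zero, smul_zero]
  · rw [h2, bracket_x_y, map_neg, smul_neg, hεδ']
  · rw [bracket_swap (h v), bracket_h_x, bracket_swap (ψ (h v)), H, smul_neg, hεδ', map_neg]
  · rw [bracket_swap (x v), bracket_x_y, bracket_swap (ψ (x v)), h2, neg_neg, neg_neg, hεδ']
  · rw [bracket_self, bracket_self, map_zero, smul_zero]
  · rw [bracket_swap (h v), bracket_h_y, bracket_swap (ψ (h v)), h1, neg_neg, neg_neg, hεδ']
  · rw [bracket_h_x, H, hεδ']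
  · rw [bracket_h_y, h1, map_neg, smul_neg, hεδ']
  · rw [bracket_self, bracket_self, map_zero, smul_zero]

theorem IsPoissonUpTo.mul {ε ε' : k} {φ ψ : B v ≃ₐ[k] B v} (hφ : IsPoissonUpTo ε φ)
    (hψ : IsPoissonUpTo ε' ψ) : IsPoissonUpTo (ε' * ε) (φ * ψ) := by
  intro f g
  rw [AlgEquiv.mul_apply, hψ, map_smul, hφ, smul_smul]
  rfl

theorem y_mul_x (v : k[X]) : y v * x v = aeval (h v) v := by rw [mul_comm, x_mul_y]

/-- The automorphism of `B(v)` exchanging `x` and `y`. -/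
noncomputable def swap (v : k[X]) : B v ≃ₐ[k] B v :=
  AlgEquiv.ofAlgHom (lift v (y v) (x v) (h v) (y_mul_x v))
    (lift v (y v) (x v) (h v) (y_mul_x v))
    (by apply algHom_ext <;> simp [lift_x, lift_y, lift_h])
    (by apply algHom_ext <;> simp [lift_x, lift_y, lift_h])

@[simp] theorem swap_x : swap v (x v) = y v := lift_x v _ _ _ (y_mul_x v)
@[simp] theorem swap_y : swap v (y v) = x v := lift_y v _ _ _ (y_mul_x v)
@[simp] theorem swap_h : swap v (h v) = h v := lift_h v _ _ _ (y_mul_x v)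

theorem algEquiv_ext {φ ψ : B v ≃ₐ[k] B v} (ex : φ (x v) = ψ (x v)) (ey : φ (y v) = ψ (y v))
    (eh : φ (h v) = ψ (h v)) : φ = ψ := by
  have : φ.toAlgHom = ψ.toAlgHom := algHom_ext ex ey eh
  ext b
  exact congrArg (fun θ => θ b) this

theorem swap_mul_swap : swap v * swap v = 1 := by
  apply algEquiv_ext <;> simp [AlgEquiv.mul_apply]

theorem swap_swap (b : B v) : swap v (swap v b) = b :=
  congrArg (fun θ : B v ≃ₐ[k] B v => θ b) swap_mul_swap

theorem isPoissonUpTo_swap (hv : v ≠ 0) : IsPoissonUpTo (-1 : k) (swap v) := by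
  refine isPoissonUpTo_of_bracket_h_x hv (δ := -1) (by ring) ?_
  rw [swap_h, swap_x, bracket_h_y, neg_one_smul]

theorem algEquiv_ext_of_x_h (hv : v ≠ 0) {φ ψ : B v ≃ₐ[k] B v} (ex : φ (x v) = ψ (x v))
    (eh : φ (h v) = ψ (h v)) : φ = ψ := by
  refine algEquiv_ext ex ?_ eh
  have hx0 : φ (x v) ≠ 0 := (map_ne_zero_iff _ φ.injective).mpr (x_ne_zero v)
  apply mul_left_cancel_of_ne_zero hv hx0
  have key : ∀ θ : B v ≃ₐ[k] B v, θ (x v) * θ (y v) = aeval (θ (h v)) v := fun θ => by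
    rw [← map_mul, x_mul_y]
    exact (aeval_algHom_apply θ.toAlgHom (h v) v).symm
  rw [key φ, ex, key ψ, eh]

theorem exists_x_mul_eq (μ : k) {m : ℕ} (hm : 1 ≤ m) :
    ∃ b : B v, x v * b = aeval (h v + μ • x v ^ m) v := by
  have h1 : x v ∣ aeval (h v + μ • x v ^ m) v - aeval (h v) v := by
    rw [aeval_def, aeval_def, ← eval_map, ← eval_map]
    refine dvd_trans ?_ (sub_dvd_eval_sub _ _ _)
    rw [add_sub_cancel_left, Algebra.smul_def]
    exact (dvd_pow_self _ (by omega)).mul_left _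
  obtain ⟨b, hb⟩ := h1
  exact ⟨b + y v, by rw [mul_add, x_mul_y, ← hb]; ring⟩

/-- The image of y is v(h + μx^m)/x, which exists because x divides v(h + μx^m) - v(h); the inverse
is the shear with -μ. No factorials are inverted here. -/
theorem exists_shear (hv : v ≠ 0) (μ : k) {m : ℕ} (hm : 1 ≤ m) :
    ∃ E : B v ≃ₐ[k] B v, E (x v) = x v ∧ E (h v) = h v + μ • x v ^ m := by
  obtain ⟨b, hb⟩ := exists_x_mul_eq (v := v) μ hm
  obtain ⟨b', hb'⟩ := exists_x_mul_eq (v := v) (-μ) hm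
  have key : ∀ (ν : k) (c c' : B v) (e : x v * c = aeval (h v + ν • x v ^ m) v)
      (e' : x v * c' = aeval (h v + (-ν) • x v ^ m) v),
      (lift v (x v) c (h v + ν • x v ^ m) e).comp (lift v (x v) c' (h v + (-ν) • x v ^ m) e')
        = AlgHom.id k (B v) := by
    intro ν c c' e e'
    have hh : (lift v (x v) c (h v + ν • x v ^ m) e) (h v + (-ν) • x v ^ m) = h v := by
      rw [map_add, map_smul, map_pow, lift_h, lift_x]
      module
    apply algHom_ext
    · simp [lift_x]
    · apply mul_left_cancel_of_ne_zero hv (x_ne_zero v)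
      have h1 := congrArg (lift v (x v) c (h v + ν • x v ^ m) e) e'
      rw [map_mul, lift_x, ← aeval_algHom_apply, hh] at h1
      rw [AlgHom.comp_apply, lift_y, h1, AlgHom.id_apply, x_mul_y]
    · rw [AlgHom.comp_apply, lift_h, hh, AlgHom.id_apply]
  refine ⟨AlgEquiv.ofAlgHom (lift v (x v) b (h v + μ • x v ^ m) hb)
    (lift v (x v) b' (h v + (-μ) • x v ^ m) hb') (key μ b b' hb hb') ?_, lift_x v _ _ _ hb,
    lift_h v _ _ _ hb⟩
  have := key (-μ) b' b hb' (by rw [neg_neg]; exact hb)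
  simpa only [neg_neg] using this

theorem isPoissonUpTo_of_shear (hv : v ≠ 0) {μ : k} {m : ℕ} {E : B v ≃ₐ[k] B v}
    (hx : E (x v) = x v) (hh : E (h v) = h v + μ • x v ^ m) : IsPoissonUpTo (1 : k) E := by
  refine isPoissonUpTo_of_bracket_h_x hv (δ := 1) (by ring) ?_
  rw [hx, hh, bracket_swap, bracket_add, bracket_smul, ← ad_apply (x v) (x v ^ m),
    Derivation.leibniz_pow, ad_x_x, smul_zero, smul_zero, smul_zero, add_zero, ← bracket_swap,
    bracket_h_x, one_smul]

end Automorphisms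

/-! ### Shears as exponentials, and conjugation of W by the exchange -/

section TameGroup

variable {k : Type*} [Field k] {v : k[X]}

theorem aeval_add_eq_sum {A : Type*} [CommRing A] [Algebra k A] (P : k[X])
    (hfact : ∀ j ≤ P.natDegree, (j.factorial : k) ≠ 0) (a b : A) :
    aeval (a + b) P = ∑ j ∈ Finset.range (P.natDegree + 1),
      (j.factorial : k)⁻¹ • (aeval a (derivative^[j] P) * b ^ j) := by
  have h1 : aeval (a + b) P = (taylor a (P.map (algebraMap k A))).eval b := by
    rw [taylor_eval, eval_map_algebraMap, add_comm]
  rw [h1, eval_eq_sum_range' (n := P.natDegree + 1)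
    (by rw [natDegree_taylor]; exact Nat.lt_succ_of_le natDegree_map_le)]
  refine Finset.sum_congr rfl fun j hj => ?_
  have hj' := hfact j (Nat.lt_succ_iff.mp (Finset.mem_range.mp hj))
  rw [eq_inv_smul_iff₀ hj', taylor_coeff, ← smul_mul_assoc, aeval_def, ← eval_map,
    ← iterate_derivative_map, ← factorial_smul_hasseDeriv, LinearMap.smul_apply, eval_smul,
    Nat.cast_smul_eq_nsmul]

theorem iterate_bracket_mul_of_ker (D : Derivation k (B v) (B v)) {a : B v} (ha : D a = 0)
    (b : B v) (j : ℕ) : D^[j] (a * b) = a * D^[j] b := by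
  induction j with
  | zero => rfl
  | succ j ih =>
    rw [Function.iterate_succ_apply', ih, Derivation.leibniz, ha, smul_zero, add_zero,
      Function.iterate_succ_apply', smul_eq_mul]

theorem iterate_derivation_aeval (D : Derivation k (B v) (B v)) {a c : B v} (ha : D a = c)
    (hc : D c = 0) (P : k[X]) (j : ℕ) : D^[j] (aeval a P) = aeval a (derivative^[j] P) * c ^ j := by
  induction j with
  | zero => simp
  | succ j ih =>
    rw [Function.iterate_succ_apply', ih, Derivation.leibniz, Derivation.leibniz_pow, hc,
      Derivation.map_aeval, ha, Function.iterate_succ_apply']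
    simp only [smul_eq_mul, smul_zero, mul_zero, zero_add]
    ring

/-- Since {x^m, h} = -m x^m, the constant -μ/m gives D(h) = μx^m. The series at y is compared with
the Taylor expansion of v(h + μx^m) after multiplication by x, which D kills. -/
theorem shear_mem_W (hv : v ≠ 0) (hfact : ∀ j ≤ v.natDegree, (j.factorial : k) ≠ 0) {μ : k} {m : ℕ}
    (hm : 1 ≤ m) (hmk : (m : k) ≠ 0) {E : B v ≃ₐ[k] B v} (hx : E (x v) = x v)
    (hh : E (h v) = h v + μ • x v ^ m) : E ∈ W v := by
  refine Subgroup.subset_closure (Or.inl (Or.inl ⟨-(μ / m), m, hm, ?_⟩))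
  set D : Derivation k (B v) (B v) := (-(μ / m)) • ad (x v ^ m) with hD
  have hDfun : (fun b => (-(μ / m)) • bracket (x v ^ m) b) = D := rfl
  rw [hDfun]
  have hDx : D (x v) = 0 := by
    rw [hD, Derivation.smul_apply, ad_apply, bracket_swap, ← ad_apply, Derivation.leibniz_pow,
      ad_x_x, smul_zero, smul_zero, neg_zero, smul_zero]
  have hDh : D (h v) = μ • x v ^ m := by
    rw [hD, Derivation.smul_apply, ad_apply, bracket_swap, ← ad_apply, Derivation.leibniz_pow,
      ad_apply, bracket_h_x, smul_eq_mul, ← pow_succ, Nat.sub_add_cancel hm,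
      ← Nat.cast_smul_eq_nsmul k, smul_neg, neg_smul, neg_neg, smul_smul, div_mul_cancel₀ _ hmk]
  have hDh' : D (μ • x v ^ m) = 0 := by
    rw [Derivation.map_smul, Derivation.leibniz_pow, hDx, smul_zero, smul_zero, smul_zero]
  rintro g (rfl | rfl | rfl)
  · exact ⟨1, by simp, hDx, by simp [hx]⟩
  · have hxD : ∀ j, x v * D^[j] (y v) = aeval (h v) (derivative^[j] v) * (μ • x v ^ m) ^ j :=
      fun j => by
        rw [← iterate_bracket_mul_of_ker D hDx, x_mul_y, iterate_derivation_aeval D hDh hDh']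
    refine ⟨v.natDegree + 1, fun j hj => hfact j (Nat.lt_succ_iff.mp hj), ?_, ?_⟩
    · apply mul_left_cancel_of_ne_zero hv (x_ne_zero v)
      rw [hxD, iterate_derivative_eq_zero (Nat.lt_succ_self _), map_zero, zero_mul, mul_zero]
    · apply mul_left_cancel_of_ne_zero hv (x_ne_zero v)
      have h1 : x v * E (y v) = aeval (E (h v)) v := by
        conv_lhs => rw [← hx]
        rw [← map_mul, x_mul_y]
        exact (aeval_algHom_apply E.toAlgHom (h v) v).symm
      rw [h1, hh, aeval_add_eq_sum v hfact, Finset.mul_sum]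
      refine Finset.sum_congr rfl fun j _ => ?_
      rw [mul_smul_comm, hxD]
  · refine ⟨2, fun j hj => by interval_cases j <;> simp, ?_, ?_⟩
    · rw [Function.iterate_succ_apply, hDh, Function.iterate_one, hDh']
    · rw [Finset.sum_range_succ, Finset.sum_range_one, hh, Function.iterate_one, hDh]
      simp

theorem swap_bracket (hv : v ≠ 0) (f g : B v) :
    swap v (bracket f g) = - bracket (swap v f) (swap v g) := by
  rw [isPoissonUpTo_swap hv, neg_one_smul]

theorem IsExp.swap_conj {D D' : B v → B v} (hD : ∀ b, swap v (D b) = D' (swap v b))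
    {φ : B v ≃ₐ[k] B v} (hφ : IsExp D φ) : IsExp D' (swap v * φ * swap v) := by
  have hiter : ∀ j b, swap v (D^[j] b) = D'^[j] (swap v b) := fun j b =>
    Function.Semiconj.iterate_right (f := swap v) hD j b
  intro g hg
  have hg' : swap v g ∈ ({x v, y v, h v} : Set (B v)) := by
    rcases hg with rfl | rfl | rfl <;> simp
  obtain ⟨m, hm, h0, hs⟩ := hφ _ hg'
  refine ⟨m, hm, ?_, ?_⟩
  · have := hiter m (swap v g)
    rw [h0, map_zero, swap_swap] at this
    exact this.symm
  · rw [AlgEquiv.mul_apply, AlgEquiv.mul_apply, hs, map_sum]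
    refine Finset.sum_congr rfl fun j _ => ?_
    rw [map_smul, hiter, swap_swap]

/-- Conjugation exchanges the two families of exponentials, with c replaced by -c because the
bracket changes sign, and inverts t in the diagonal maps. -/
theorem swap_conj_mem_W (hv : v ≠ 0) {w : B v ≃ₐ[k] B v} (hw : w ∈ W v) :
    swap v * w * swap v ∈ W v := by
  have hinv : (swap v)⁻¹ = swap v := inv_eq_of_mul_eq_one_right swap_mul_swap
  suffices W v ≤ (W v).comap (MulAut.conj (swap v)).toMonoidHom by
    have h1 := this hw
    rw [Subgroup.mem_comap] at h1
    simpa [MulAut.conj_apply, hinv] using h1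
  rw [W, Subgroup.closure_le]
  rintro φ ((⟨c, n, hn, hφ⟩ | ⟨c, n, hn, hφ⟩) | ⟨t, rfl⟩)
  all_goals
    rw [SetLike.mem_coe, Subgroup.mem_comap]
    simp only [MulEquiv.toMonoidHom_eq_coe, MonoidHom.coe_coe, MulAut.conj_apply, hinv]
  · refine Subgroup.subset_closure (Or.inl (Or.inr ⟨-c, n, hn, hφ.swap_conj fun b => ?_⟩))
    rw [map_smul, swap_bracket hv, map_pow, swap_x, smul_neg, neg_smul]
  · refine Subgroup.subset_closure (Or.inl (Or.inl ⟨-c, n, hn, hφ.swap_conj fun b => ?_⟩))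
    rw [map_smul, swap_bracket hv, map_pow, swap_y, smul_neg, neg_smul]
  · refine Subgroup.subset_closure (Or.inr ⟨t⁻¹, ?_⟩)
    apply algEquiv_ext <;> simp [diagonal, lift_x, lift_y, lift_h]

end TameGroup

/-! ### Elements with small leading exponent -/

section Low

variable {k : Type*} [Field k] {v : k[X]}

theorem Lead.lt_of_zero {f : AddMonoidAlgebra k Expo} {e e' : Expo} {c : k} (hf : Lead f e 0)
    (hf' : Lead f e' c) (hc : c ≠ 0) : e' < e :=
  lt_of_le_of_ne (hf'.le hf hc) fun h => hc (hf'.2.symm.trans (h ▸ hf.2))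

theorem eq_zero_of_wt_nonpos (hv : 1 ≤ v.natDegree) {b : B v} {e : Expo} {c : k}
    (hl : Lead (iota v b) e c) (hc : c ≠ 0) (he : wt e ≤ 0) : e = 0 := by
  obtain ⟨h1, h2, -⟩ := wt_nonneg_of_lead hv hl hc
  exact Expo.ext (by rw [map_zero]; omega) (by rw [map_zero]; omega)

theorem ne_zero_of_natDegree_pos (hv : 1 ≤ v.natDegree) : v ≠ 0 := by rintro rfl; simp at hv

theorem eq_algebraMap_of_lead_zero (hv : 1 ≤ v.natDegree) {b : B v} {c : k}
    (hl : Lead (iota v b) 0 c) : b = algebraMap k (B v) c := by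
  by_contra hne
  obtain ⟨e, c', hc', hl'⟩ := exists_lead_iota (ne_zero_of_natDegree_pos hv) (sub_ne_zero.mpr hne)
  have h0 : Lead (iota v (b - algebraMap k (B v) c)) 0 0 := by
    rw [map_sub, AlgHom.commutes]
    exact (hl.sub (lead_algebraMap c)).congr rfl rfl (sub_self c)
  have hlt := h0.lt_of_zero hl' hc'
  have := eq_zero_of_wt_nonpos hv hl' hc' (by simpa using wt_mono hlt.le)
  exact hlt.ne this

theorem wt_pos_of_lead (hv : 1 ≤ v.natDegree) {b : B v} {e : Expo} {c : k}
    (hl : Lead (iota v b) e c) (hc : c ≠ 0) (hb : ∀ a, b ≠ algebraMap k (B v) a) : 0 < wt e := by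
  by_contra! hle
  have := eq_zero_of_wt_nonpos hv hl hc hle
  subst this
  exact hb c (eq_algebraMap_of_lead_zero hv hl)

theorem eq_smul_x_add_of_lead_ex (hv : 1 ≤ v.natDegree) {b : B v} {c : k}
    (hl : Lead (iota v b) ex c) : ∃ γ : k, b = c • x v + algebraMap k (B v) γ := by
  rcases eq_or_ne (b - c • x v) 0 with h0 | hne
  · exact ⟨0, by rw [map_zero, add_zero]; exact sub_eq_zero.mp h0⟩
  obtain ⟨e, c', hc', hl'⟩ := exists_lead_iota (ne_zero_of_natDegree_pos hv) hne
  have h0 : Lead (iota v (b - c • x v)) ex 0 := by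
    rw [map_sub, map_smul]
    exact (hl.sub ((lead_iota_x v).smul c)).congr rfl rfl (by ring)
  have hlt := h0.lt_of_zero hl' hc'
  obtain ⟨h1, h2, h3⟩ := wt_nonneg_of_lead hv hl' hc'
  have he : e = 0 := eq_zero_of_wt_nonpos hv hl' hc' (by
    rw [Expo.lt_iff] at hlt
    simp only [wt_ex, hdeg_ex] at hlt
    omega)
  subst he
  exact ⟨c', by rw [← eq_algebraMap_of_lead_zero hv hl']; ring⟩

/-- The basis monomials not exceeding h are 1, x, x², x³, h and, only for n = 1, also y. -/
theorem eq_sum_of_lead_eh (hv : 1 ≤ v.natDegree) {b : B v} {c : k} (hl : Lead (iota v b) eh c) :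
    ∃ (r : ℕ → k) (s : k), (2 ≤ v.natDegree → s = 0) ∧
      b = algebraMap k (B v) (r 0) + r 1 • x v + r 2 • x v ^ 2 + r 3 • x v ^ 3 + c • h v
        + s • y v := by
  obtain ⟨f, hf⟩ := exists_eq_linearCombination b
  have hle := expo_le_of_lead (ne_zero_of_natDegree_pos hv) (hf ▸ hl)
  have hcases : ∀ q ∈ f.support, q ∈ ({(0, 0), (1, 0), (2, 0), (3, 0), (0, 1), (-1, 0)} :
      Finset (ℤ × ℕ)) ∧ (q = (-1, 0) → v.natDegree = 1) := by
    rintro ⟨i, j⟩ hq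
    have h1 := Expo.le_iff.mp (hle _ hq)
    have h2 := natDegree_mul_add_top_nonneg v (i, j)
    simp only [wt_expo, hdeg_expo, wt_eh, hdeg_eh] at h1 h2
    have hn : (1 : ℤ) ≤ v.natDegree := by exact_mod_cast hv
    have h3 : 0 ≤ i + top v (i, j) := by
      by_contra! hlt
      have : (0 : ℤ) ≤ top v (i, j) := by positivity
      nlinarith
    have htop : top v (i, j) ≤ 1 := by omega
    have htop' : top v (i, j) = j + v.natDegree * (-i).toNat := rfl
    rcases le_or_gt 0 i with hi | hi
    · have e1 : (-i).toNat = 0 := by omega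
      rw [e1, mul_zero, add_zero] at htop'
      rw [htop'] at h1 htop
      have hj : j = 0 ∨ j = 1 := by omega
      rcases hj with rfl | rfl
      · have : i ≤ 3 := by omega
        interval_cases i <;> simp
      · have : i = 0 := by omega
        subst this; simp
    · have e1 : 1 ≤ (-i).toNat := by omega
      have e2 : v.natDegree * 1 ≤ v.natDegree * (-i).toNat := Nat.mul_le_mul_left _ e1
      have e3 : (-i).toNat ≤ v.natDegree * (-i).toNat := Nat.le_mul_of_pos_left _ hv
      have e4 : i = -1 := by omega
      have e5 : j = 0 := by omega
      subst e4 e5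
      refine ⟨by simp, fun _ => by omega⟩
  have hsub : f.support ⊆ ({(0, 0), (1, 0), (2, 0), (3, 0), (0, 1), (-1, 0)} :
      Finset (ℤ × ℕ)) := fun q hq => (hcases q hq).1
  have hb : b = algebraMap k (B v) (f (0, 0)) + f (1, 0) • x v + f (2, 0) • x v ^ 2
      + f (3, 0) • x v ^ 3 + f (0, 1) • h v + f (-1, 0) • y v := by
    rw [hf, Finset.sum_subset hsub fun q _ hq => by rw [Finsupp.notMem_support_iff.mp hq, zero_smul]]
    rw [Finset.sum_insert (by decide), Finset.sum_insert (by decide), Finset.sum_insert (by decide),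
      Finset.sum_insert (by decide), Finset.sum_insert (by decide), Finset.sum_singleton]
    simp only [mon, Algebra.algebraMap_eq_smul_one]
    simp
    ring
  have hc : f (0, 1) = c := by
    by_contra hne
    have h1 : Lead (iota v b) eh (f (0, 1)) := by
      have hn : (1 : ℤ) ≤ v.natDegree := by exact_mod_cast hv
      have hpow : ∀ m : ℕ, m ≤ 3 → ∀ a : k, Lead (iota v (a • x v ^ m)) eh 0 := by
        intro m hm a
        rw [map_smul, map_pow]
        refine (((lead_iota_x v).pow m).smul a).of_lt (Expo.lt_iff.mpr ?_)
        simp; omega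
      have hy : Lead (iota v (f (-1, 0) • y v)) eh 0 := by
        rcases eq_or_ne (f (-1, 0)) 0 with h0 | h0
        · rw [h0, zero_smul, map_zero]; exact Lead.zero _
        · have h1 := (hcases (-1, 0) (Finsupp.mem_support_iff.mpr h0)).2 rfl
          rw [map_smul]
          refine ((lead_iota_y v).smul _).of_lt (Expo.lt_iff.mpr ?_)
          simp [h1]
      have h0 : Lead (iota v (algebraMap k (B v) (f (0, 0)))) eh 0 := by
        rw [AlgHom.commutes]
        exact (lead_algebraMap _).of_lt eh_pos
      have hx : Lead (iota v (f (1, 0) • x v)) eh 0 := by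
        simpa using hpow 1 (by norm_num) (f (1, 0))
      rw [hb]
      simp only [map_add]
      refine (((((h0.add hx).add (hpow 2 (by norm_num) _)).add (hpow 3 (by norm_num) _)).add
        (c' := f (0, 1)) ?_).add hy).congr rfl rfl (by simp)
      rw [map_smul]
      exact ((lead_iota_h v).smul _).congr rfl rfl (mul_one _)
    exact hne (h1.unique_coeff hl)
  refine ⟨fun i => f (i, 0), f (-1, 0), fun h2 => ?_, ?_⟩
  · by_contra hne
    have := (hcases (-1, 0) (Finsupp.mem_support_iff.mpr hne)).2 rfl
    omega
  · rw [← hc]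
    simpa using hb

end Low

/-! ### Normal form of an automorphism with the smallest leading exponents -/

section Normal

variable {k : Type*} [Field k] {v : k[X]}

theorem map_mul_map_eq_aeval (ψ : B v ≃ₐ[k] B v) : ψ (x v) * ψ (y v) = aeval (ψ (h v)) v := by
  rw [← map_mul, x_mul_y]
  exact (aeval_algHom_apply ψ.toAlgHom (h v) v).symm

/-- A nonzero polynomial in `h` divisible by `x` has degree at least `deg v`. -/
theorem eq_zero_of_x_mul_eq_aeval (hv : 1 ≤ v.natDegree) {b : B v} {r : k[X]}
    (e : x v * b = aeval (h v) r) (hr : r ≠ 0 → r.natDegree < v.natDegree) : r = 0 := by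
  by_contra hr0
  have hlr : Lead (iota v (aeval (h v) r)) (r.natDegree • eh) (r.leadingCoeff * 1) := by
    rw [← aeval_algHom_apply]
    exact ((lead_iota_h v).aeval eh_pos r le_rfl).congr rfl rfl (by simp)
  have hrc : r.leadingCoeff * 1 ≠ 0 := by rwa [mul_one, leadingCoeff_ne_zero]
  have hb0 : b ≠ 0 := by
    rintro rfl
    rw [← e, mul_zero, map_zero] at hlr
    exact hlr.ne_zero hrc rfl
  obtain ⟨e', c', hc', hl'⟩ := exists_lead_iota (ne_zero_of_natDegree_pos hv) hb0
  have h1 := (lead_iota_x v).mul hl'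
  rw [← map_mul, e] at h1
  have h2 := h1.unique hlr (by simpa using hc') hrc
  have hw := congrArg wt h2
  have hd := congrArg hdeg h2
  simp only [map_add, map_nsmul, wt_ex, hdeg_ex, wt_eh, hdeg_eh, nsmul_eq_mul] at hw hd
  obtain ⟨-, -, h3⟩ := wt_nonneg_of_lead hv hl' hc'
  have h4 : wt e' - 3 * hdeg e' = -1 := by linarith
  rw [h4] at h3
  have h5 := hr hr0
  have h6 : hdeg e' = r.natDegree := by linarith
  omega

/-- Composition with an element of the tame group making `φ` monomial on `x` and affine on `h`. -/
def IsAffine (ε : k) (ψ : B v ≃ₐ[k] B v) : Prop :=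
  ∃ t q : k, t ≠ 0 ∧ ψ (x v) = t • x v ∧ ψ (h v) = ε • h v + algebraMap k (B v) q

/-- v(εh + q) = t x ψ(y) and v(h) = xy are both divisible by x. The difference v(εh + q) - ε^n v(h)
is therefore divisible by x and has degree below n, so it is zero. -/
theorem comp_eq_of_map_eq (hv : 1 ≤ v.natDegree) {ε : k} (hε : ε ≠ 0) {ψ : B v ≃ₐ[k] B v} {t q : k}
    (ht : ψ (x v) = t • x v) (hq : ψ (h v) = ε • h v + algebraMap k (B v) q) :
    v.comp (C ε * X + C q) = C (ε ^ v.natDegree) * v := by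
  have hlin : (C ε * X + C q : k[X]).natDegree ≤ 1 := natDegree_linear_le
  have e1 : aeval (ψ (h v)) v = aeval (h v) (v.comp (C ε * X + C q)) := by
    rw [aeval_comp, hq]
    congr 2
    simp [Algebra.smul_def]
  have e := map_mul_map_eq_aeval ψ
  rw [e1, ht] at e
  rw [← sub_eq_zero]
  refine eq_zero_of_x_mul_eq_aeval hv (b := t • ψ (y v) - ε ^ v.natDegree • y v) ?_ ?_
  · rw [map_sub, ← e, map_mul, aeval_C, ← x_mul_y, Algebra.smul_def, Algebra.smul_def,
      Algebra.smul_def]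
    ring
  · intro hne
    have hle : (v.comp (C ε * X + C q) - C (ε ^ v.natDegree) * v).natDegree ≤ v.natDegree := by
      have h1 : (v.comp (C ε * X + C q)).natDegree ≤ v.natDegree :=
        natDegree_comp_le.trans ((Nat.mul_le_mul_left _ hlin).trans (mul_one _).le)
      exact (natDegree_sub_le_of_le h1 (natDegree_C_mul_le _ _)).trans (max_self _).le
    refine lt_of_le_of_ne hle fun heq => hne ?_
    rw [← leadingCoeff_eq_zero, leadingCoeff, heq, coeff_sub, coeff_C_mul]
    have := coeff_comp_degree_mul_degree (p := v) (q := C ε * X + C q)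
    rw [natDegree_linear hε, mul_one] at this
    rw [this (by norm_num), leadingCoeff_linear hε, leadingCoeff]
    ring

/-- The bracket of h and x forces β = ε and makes s proportional to γ. One of the two is zero by
assumption on the degree, hence both are, and shears remove the powers of x from ψ(h). -/
theorem exists_isAffine_of_map_x (hv : 1 ≤ v.natDegree)
    (hfact : ∀ j ≤ v.natDegree, (j.factorial : k) ≠ 0) (h2 : (2 : k) ≠ 0) (h3 : (3 : k) ≠ 0)
    {ε α β : k} (hε : ε * ε = 1) {ψ : B v ≃ₐ[k] B v} (hψ : IsPoissonUpTo ε ψ) (hα : α ≠ 0)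
    {γ : k} (hX : ψ (x v) = α • x v + algebraMap k (B v) γ) (hγ : v.natDegree = 1 → γ = 0)
    (hH : Lead (iota v (ψ (h v))) eh β) : ∃ w ∈ W v, IsAffine ε (ψ * w) := by
  have hv0 := ne_zero_of_natDegree_pos hv
  obtain ⟨r, s, hs, hr⟩ := eq_sum_of_lead_eh hv hH
  have hbr : ad (x v) (ψ (h v)) = -(β • x v) - s • aeval (h v) (derivative v) := by
    rw [hr]
    simp only [map_add, Derivation.map_algebraMap, Derivation.map_smul, Derivation.leibniz_pow,
      ad_x_x, ad_x_h, smul_zero, zero_add]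
    rw [ad_apply, bracket_x_y, smul_neg, smul_neg]
    ring
  have hε0 : ε ≠ 0 := by rintro rfl; simp at hε
  -- the bracket relation `{h, x} = x` transported by `ψ`
  have hrel : α • (β • x v + s • aeval (h v) (derivative v))
      = ε • (α • x v + algebraMap k (B v) γ) := by
    have e := hψ (h v) (x v)
    rw [bracket_h_x, hX, bracket_add, bracket_algebraMap, add_zero, bracket_smul, bracket_swap (x v),
      ← ad_apply, hbr] at e
    rw [e, smul_smul, hε, one_smul]
    congr 1
    ring
  have hsv : s • aeval (h v) (derivative v) = algebraMap k (B v) (s * v.leadingCoeff) := by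
    rcases Nat.lt_or_ge v.natDegree 2 with hlt | hge
    · have hn : v.natDegree = 1 := by omega
      have hd : derivative v = C v.leadingCoeff := by
        rw [eq_C_of_natDegree_le_zero ((natDegree_derivative_le v).trans (by omega)),
          coeff_derivative, leadingCoeff, hn]
        simp
      rw [hd, aeval_C, Algebra.smul_def, map_mul]
    · rw [hs hge]; simp
  rw [hsv] at hrel
  have hrel' : (α * β - ε * α) • x v + algebraMap k (B v) (α * (s * v.leadingCoeff) - ε * γ) = 0 := by
    rw [sub_smul, map_sub, map_mul, map_mul _ ε, ← Algebra.smul_def α, ← Algebra.smul_def ε,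
      mul_smul, mul_smul]
    rw [smul_add, smul_add] at hrel
    linear_combination hrel
  have hcoef : α * β - ε * α = 0 := by
    have h1 : Lead (iota v ((α * β - ε * α) • x v +
        algebraMap k (B v) (α * (s * v.leadingCoeff) - ε * γ))) ex ((α * β - ε * α) * 1 + 0) := by
      rw [map_add, map_smul, AlgHom.commutes]
      exact ((lead_iota_x v).smul _).add ((lead_algebraMap _).of_lt ex_pos)
    rw [hrel', map_zero] at h1
    simpa using h1.unique_coeff (Lead.zero ex)
  have hconst : α * (s * v.leadingCoeff) - ε * γ = 0 := by
    rw [hcoef, zero_smul, zero_add] at hrel'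
    have h1 : Lead (iota v (algebraMap k (B v) (α * (s * v.leadingCoeff) - ε * γ))) 0
        (α * (s * v.leadingCoeff) - ε * γ) := by
      rw [AlgHom.commutes]; exact lead_algebraMap _
    rw [hrel', map_zero] at h1
    exact h1.unique_coeff (Lead.zero 0)
  have hβ : β = ε := by
    apply mul_left_cancel₀ hα
    linear_combination hcoef
  subst hβ
  have hγs : γ = 0 ∧ s = 0 := by
    rcases Nat.lt_or_ge v.natDegree 2 with hlt | hge
    · have h0 := hγ (by omega)
      rw [h0, mul_zero, sub_zero] at hconst
      exact ⟨h0, by simpa [hα, hv0] using hconst⟩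
    · have h0 := hs hge
      rw [h0] at hconst
      exact ⟨by simpa [hε0] using hconst, h0⟩
  obtain ⟨rfl, rfl⟩ := hγs
  rw [map_zero, add_zero] at hX
  rw [zero_smul, add_zero] at hr
  -- Three shears suffice because h has weight 3; this is where 2 and 3 must be invertible.
  obtain ⟨E₁, hE₁x, hE₁h⟩ := exists_shear hv0 (-(r 1) / α) (le_refl 1)
  obtain ⟨E₂, hE₂x, hE₂h⟩ := exists_shear hv0 (-(r 2) / α ^ 2) (by norm_num : 1 ≤ 2)
  obtain ⟨E₃, hE₃x, hE₃h⟩ := exists_shear hv0 (-(r 3) / α ^ 3) (by norm_num : 1 ≤ 3)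
  have hm₁ := shear_mem_W hv0 hfact (le_refl 1) (by simp) hE₁x hE₁h
  have hm₂ := shear_mem_W hv0 hfact (by norm_num) (by exact_mod_cast h2) hE₂x hE₂h
  have hm₃ := shear_mem_W hv0 hfact (by norm_num) (by exact_mod_cast h3) hE₃x hE₃h
  refine ⟨E₁ * E₂ * E₃, mul_mem (mul_mem hm₁ hm₂) hm₃, α, r 0, hα, ?_, ?_⟩
  · simp only [AlgEquiv.mul_apply, hE₁x, hE₂x, hE₃x, hX]
  · simp only [AlgEquiv.mul_apply, hE₁x, hE₂x, hE₁h, hE₂h, hE₃h, map_add, map_smul, map_pow,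
      hX, hr, _root_.smul_pow, smul_smul, pow_one]
    rw [div_mul_cancel₀ _ hα, div_mul_cancel₀ _ (pow_ne_zero 2 hα),
      div_mul_cancel₀ _ (pow_ne_zero 3 hα)]
    module

theorem exists_isAffine (hv : 1 ≤ v.natDegree)
    (hfact : ∀ j ≤ v.natDegree, (j.factorial : k) ≠ 0) (h2 : (2 : k) ≠ 0) (h3 : (3 : k) ≠ 0)
    {ε α β : k} (hε : ε * ε = 1) {ψ : B v ≃ₐ[k] B v} (hψ : IsPoissonUpTo ε ψ) (hα : α ≠ 0)
    (hβ : β ≠ 0) (hX : Lead (iota v (ψ (x v))) ex α) (hH : Lead (iota v (ψ (h v))) eh β) :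
    ∃ w ∈ W v, IsAffine ε (ψ * w) := by
  have hv0 := ne_zero_of_natDegree_pos hv
  obtain ⟨γ, hγ⟩ := eq_smul_x_add_of_lead_ex hv hX
  rcases Nat.lt_or_ge v.natDegree 2 with hlt | hge
  · have hn : v.natDegree = 1 := by omega
    have hvv : v = C v.leadingCoeff * X + C (v.coeff 0) := by
      conv_lhs => rw [eq_X_add_C_of_natDegree_le_one (le_of_eq hn)]
      rw [leadingCoeff, hn]
    have hlc : v.leadingCoeff ≠ 0 := leadingCoeff_ne_zero.mpr hv0
    -- For n = 1 the shear in y translates x by μ times the leading coefficient of v; this μ cancels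
    -- γ.
    set μ : k := -γ / v.leadingCoeff with hμ
    obtain ⟨E, hEx, hEh⟩ := exists_shear hv0 μ (le_refl 1)
    have hmem := swap_conj_mem_W hv0 (shear_mem_W hv0 hfact (le_refl 1) (by simp) hEx hEh)
    set F := swap v * E * swap v with hF
    rw [pow_one] at hEh
    have hEy : E (y v) = y v + algebraMap k (B v) (μ * v.leadingCoeff) := by
      apply mul_left_cancel_of_ne_zero hv0 (x_ne_zero v)
      have e := map_mul_map_eq_aeval E
      rw [hEx, hEh] at e
      have e2 : ∀ b : B v, aeval b v = algebraMap k (B v) v.leadingCoeff * b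
          + algebraMap k (B v) (v.coeff 0) := by
        intro b
        exact (congrArg (aeval b) hvv).trans (by simp)
      rw [e, mul_add, x_mul_y, e2, e2, map_mul, Algebra.smul_def]
      ring
    have hFx : F (x v) = x v + algebraMap k (B v) (μ * v.leadingCoeff) := by
      rw [hF, AlgEquiv.mul_apply, AlgEquiv.mul_apply, swap_x, hEy, map_add, swap_y,
        AlgEquiv.commutes]
    have hFh : F (h v) = h v + μ • y v := by
      rw [hF, AlgEquiv.mul_apply, AlgEquiv.mul_apply, swap_h, hEh, map_add, swap_h, map_smul, swap_x]
    have hFp : IsPoissonUpTo (1 : k) F := by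
      have := ((isPoissonUpTo_swap hv0).mul (isPoissonUpTo_of_shear hv0 (m := 1) hEx
        (by rw [pow_one]; exact hEh))).mul (isPoissonUpTo_swap hv0)
      simpa using this
    obtain ⟨eY, η, hη, hY⟩ := exists_lead_iota hv0 (b := ψ (y v))
      ((map_ne_zero_iff _ ψ.injective).mpr fun h0 => x_ne_zero v (by
        rw [← swap_y (v := v), h0, map_zero]))
    have hsum : ex + eY = eh := by
      have e := map_mul_map_eq_aeval ψ
      have h1 := hX.mul hY
      have h4 := hH.aeval eh_pos v le_rfl
      rw [← map_mul, e, ← aeval_algHom_apply] at h1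
      have h5 := h1.unique h4 (mul_ne_zero hα hη)
        (mul_ne_zero (by rwa [← leadingCoeff]) (pow_ne_zero _ hβ))
      rw [h5, hn, one_smul]
    have hYlt : eY < eh := by
      rw [← hsum]; exact lt_add_of_pos_left _ ex_pos
    have hX' : (ψ * F) (x v) = α • x v + algebraMap k (B v) 0 := by
      rw [AlgEquiv.mul_apply, hFx, map_add, hγ, AlgEquiv.commutes, add_assoc, ← map_add, hμ,
        div_mul_cancel₀ _ hlc, add_neg_cancel]
    have hH' : Lead (iota v ((ψ * F) (h v))) eh β := by
      rw [AlgEquiv.mul_apply, hFh, map_add, map_smul, map_add, map_smul]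
      exact (hH.add ((hY.smul μ).of_lt hYlt)).congr rfl rfl (add_zero _)
    obtain ⟨w, hw, hww⟩ := exists_isAffine_of_map_x hv hfact h2 h3 (ε := ε) hε
      (by simpa using hψ.mul hFp) hα hX' (fun _ => rfl) hH'
    exact ⟨F * w, mul_mem hmem hw, by rwa [← mul_assoc]⟩
  · exact exists_isAffine_of_map_x hv hfact h2 h3 hε hψ hα hγ (fun h1 => by omega) hH

end Normal

/-! ### Descent on the leading exponent of φ(h) -/

section Descent

variable {k : Type*} [Field k] {v : k[X]}

/-- `ψ(x)` and `ψ(h)` have the same leading exponents as `x` and `h`. -/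
def IsReduced (ψ : B v ≃ₐ[k] B v) : Prop :=
  ∃ α β : k, α ≠ 0 ∧ β ≠ 0 ∧ Lead (iota v (ψ (x v))) ex α ∧ Lead (iota v (ψ (h v))) eh β

theorem natDegree_ev_one_le (hv : 1 ≤ v.natDegree) {b : B v} {e : Expo} {c : k}
    (hl : Lead (iota v b) e c) : (ev v 1 one_ne_zero b).natDegree ≤ (wt e).toNat := by
  obtain ⟨f, rfl⟩ := exists_eq_linearCombination b
  refine natDegree_ev_le 1 one_ne_zero f fun q hq => ?_
  have h1 := wt_mono (expo_le_of_lead (ne_zero_of_natDegree_pos hv) hl q hq)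
  have h2 := natDegree_mul_add_top_nonneg v q
  have hn : (1 : ℤ) ≤ v.natDegree := by exact_mod_cast hv
  have h4 : (0 : ℤ) ≤ top v q := by positivity
  have h3 : 0 ≤ q.1 + top v q := by
    by_contra! hlt
    nlinarith
  rw [wt_expo] at h1
  omega

theorem lead_sum_eq (hv : 1 ≤ v.natDegree) {ψ : B v ≃ₐ[k] B v} {eX eY eH : Expo} {α η β : k}
    (hα : α ≠ 0) (hη : η ≠ 0) (hβ : β ≠ 0) (hX : Lead (iota v (ψ (x v))) eX α)
    (hY : Lead (iota v (ψ (y v))) eY η) (hH : Lead (iota v (ψ (h v))) eH β) (heH : 0 < eH) :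
    eX + eY = v.natDegree • eH := by
  have h1 := hX.mul hY
  rw [← map_mul, map_mul_map_eq_aeval, ← aeval_algHom_apply] at h1
  refine h1.unique (hH.aeval heH v le_rfl) (mul_ne_zero hα hη) (mul_ne_zero ?_ (pow_ne_zero _ hβ))
  exact leadingCoeff_ne_zero.mpr (ne_zero_of_natDegree_pos hv)

theorem ne_algebraMap_of_lead_pos {b : B v} {e : Expo} {c : k} (hl : Lead (iota v b) e c)
    (hc : c ≠ 0) (he : 0 < e) (a : k) : b ≠ algebraMap k (B v) a := by
  rintro rfl
  rw [AlgHom.commutes] at hl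
  exact absurd (hl.le (lead_algebraMap a) hc) (not_le.mpr he)

theorem map_ne_algebraMap {b : B v} (hb : ∀ a, b ≠ algebraMap k (B v) a) (ψ : B v ≃ₐ[k] B v)
    (a : k) : ψ b ≠ algebraMap k (B v) a := by
  intro e
  apply hb a
  apply ψ.injective
  rw [e, AlgEquiv.commutes]

theorem x_ne_algebraMap (a : k) : x v ≠ algebraMap k (B v) a :=
  ne_algebraMap_of_lead_pos (lead_iota_x v) one_ne_zero ex_pos a

theorem y_ne_algebraMap (a : k) : y v ≠ algebraMap k (B v) a := by
  rw [← swap_x]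
  exact map_ne_algebraMap x_ne_algebraMap _ a

theorem h_ne_algebraMap (a : k) : h v ≠ algebraMap k (B v) a :=
  ne_algebraMap_of_lead_pos (lead_iota_h v) one_ne_zero eh_pos a

theorem exists_lead_map (hv : 1 ≤ v.natDegree) (ψ : B v ≃ₐ[k] B v) {b : B v}
    (hb : ∀ a, b ≠ algebraMap k (B v) a) :
    ∃ e c, c ≠ 0 ∧ 0 < wt e ∧ Lead (iota v (ψ b)) e c := by
  have hne := map_ne_algebraMap hb ψ
  obtain ⟨e, c, hc, hl⟩ := exists_lead_iota (ne_zero_of_natDegree_pos hv) (b := ψ b)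
    (by simpa using hne 0)
  exact ⟨e, c, hc, wt_pos_of_lead hv hl hc hne, hl⟩

theorem pos_of_wt_pos {e : Expo} (he : 0 < wt e) : 0 < e :=
  Expo.lt_iff.mpr (Or.inl (by rwa [map_zero]))

/-- Leading exponents whose determinant with the exponent of `h` is nonzero. -/
theorem eq_ex_of_sum_eq (hv : 1 ≤ v.natDegree) {b b' : B v} {e e' : Expo} {c c' : k}
    (hl : Lead (iota v b) e c) (hc : c ≠ 0) (hl' : Lead (iota v b') e' c') (hc' : c' ≠ 0)
    (hsum : e + e' = v.natDegree • eh) (hdet : expoDet eh e ≠ 0) (hle : wt e ≤ wt e') : e = ex := by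
  obtain ⟨h1, -, h3⟩ := wt_nonneg_of_lead hv hl hc
  obtain ⟨h1', -, h3'⟩ := wt_nonneg_of_lead hv hl' hc'
  have hw := congrArg wt hsum
  have hd := congrArg hdeg hsum
  simp only [map_add, map_nsmul, wt_eh, hdeg_eh, nsmul_eq_mul] at hw hd
  simp only [expoDet, wt_eh, hdeg_eh] at hdet
  have hn : (1 : ℤ) ≤ v.natDegree := by exact_mod_cast hv
  generalize (v.natDegree : ℤ) = n at *
  obtain ⟨i, hi⟩ : ∃ i, wt e - 3 * hdeg e = i := ⟨_, rfl⟩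
  have hi' : wt e' - 3 * hdeg e' = -i := by linarith
  rw [hi] at h3
  rw [hi'] at h3'
  -- The cone inequalities leave only the exponents of x and y. The weight condition excludes y,
  -- since 3n - 1 > 1 even for n = 1; this uses the weight 3 of h.
  rcases lt_trichotomy i 0 with h | h | h
  · have h4 : n ≤ hdeg e := by nlinarith
    have h5 : hdeg e = n := by linarith
    have h6 : hdeg e' = 0 := by linarith
    have h7 : -1 ≤ i := by nlinarith
    have h8 : i = -1 := by omega
    omega
  · omega
  · have h4 : n ≤ hdeg e' := by nlinarith
    have h5 : hdeg e' = n := by linarith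
    have h6 : hdeg e = 0 := by linarith
    have h7 : i ≤ 1 := by nlinarith
    exact Expo.ext (by rw [wt_ex]; omega) (by rw [hdeg_ex]; omega)

variable [Infinite k] (p : ℕ) [Fact p.Prime] [CharP k p]

/-- The dichotomy from {h, x} = x. Both products in det(eH, eX) lie between 0 and C², so C² < p lets
vanishing pass from k to ℤ; proportionality and divisibility then give eH = m eX, and the shear
removes the leading term of ψ(h). -/
theorem isReduced_or_exists_shear (hv : 1 ≤ v.natDegree) {C : ℕ} (hCp : C * C < p)
    (hfact : ∀ j ≤ v.natDegree, (j.factorial : k) ≠ 0) {ε : k} (hε : ε ≠ 0)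
    {ψ : B v ≃ₐ[k] B v} (hψ : IsPoissonUpTo ε ψ) {eX eY eH : Expo} {α η β : k} (hα : α ≠ 0)
    (hη : η ≠ 0) (hβ : β ≠ 0) (hX : Lead (iota v (ψ (x v))) eX α)
    (hY : Lead (iota v (ψ (y v))) eY η) (hH : Lead (iota v (ψ (h v))) eH β)
    (hab : wt eX ≤ wt eY) (hC : v.natDegree * wt eH ≤ C) :
    IsReduced ψ ∨ ∃ E ∈ W v, IsPoissonUpTo ε (ψ * E) ∧ Lead (iota v ((ψ * E) (h v))) eH 0 := by
  have hv0 := ne_zero_of_natDegree_pos hv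
  have hXpos := wt_pos_of_lead hv hX hα (map_ne_algebraMap x_ne_algebraMap ψ)
  have hHpos := wt_pos_of_lead hv hH hβ (map_ne_algebraMap h_ne_algebraMap ψ)
  have hsum := lead_sum_eq hv hα hη hβ hX hY hH (pos_of_wt_pos hHpos)
  have hn : (1 : ℤ) ≤ v.natDegree := by exact_mod_cast hv
  have hwsum := congrArg wt hsum
  simp only [map_add, map_nsmul, nsmul_eq_mul] at hwsum
  have hHC : wt eH ≤ C := by nlinarith
  have hXC : wt eX ≤ C := by omega
  have hCp' : C < p := by
    rcases Nat.eq_zero_or_pos C with h0 | h0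
    · omega
    · nlinarith
  have hbr : Lead (iota v (ψ (x v))) (eH + eX - eh) (ε * ((expoDet eH eX : k) * (β * α))) := by
    have h1 := hψ (h v) (x v)
    rw [bracket_h_x] at h1
    refine (lead_smul_torusBracket ε hH hX).congr ?_ rfl rfl
    have h2 := congrArg (iota v) h1
    rw [map_smul, iota_bracket] at h2
    exact h2.symm
  -- Otherwise the bracket of ψ(h) and ψ(x) would be too small to be a multiple of ψ(x). This gives
  -- wt eH ≥ 3.
  have hehH : eh ≤ eH := by
    have h1 := hX.le hbr hα
    have h2 : eX + eh ≤ eX + eH := by rw [add_comm eX eH]; exact le_sub_iff_add_le.mp h1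
    exact le_of_add_le_add_left h2
  by_cases hdet : (expoDet eH eX : k) = 0
  · right
    have hdet0 : expoDet eH eX = 0 := by
      rw [CharP.intCast_eq_zero_iff k p] at hdet
      apply Int.eq_zero_of_abs_lt_dvd hdet
      obtain ⟨h1, h2, -⟩ := wt_nonneg_of_lead hv hX hα
      obtain ⟨h1', h2', -⟩ := wt_nonneg_of_lead hv hH hβ
      have hb1 : hdeg eH * wt eX ≤ C * C :=
        mul_le_mul (by omega) hXC (by omega) (by positivity)
      have hb2 : wt eH * hdeg eX ≤ C * C :=
        mul_le_mul hHC (by omega) (by omega) (by positivity)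
      have hb3 : 0 ≤ hdeg eH * wt eX := mul_nonneg h1' hXpos.le
      have hb4 : 0 ≤ wt eH * hdeg eX := mul_nonneg hHpos.le h1
      have hb5 : ((C * C : ℕ) : ℤ) < p := by exact_mod_cast hCp
      push_cast at hb5
      rw [expoDet, abs_lt]
      constructor <;> omega
    obtain ⟨m, hm⟩ := wt_dvd_wt_of_wt_le p hv hψ hα hβ hX hY hH hsum hXpos hab
      (by simpa using wt_mono hehH) (by omega)
      ((natDegree_ev_one_le hv hX).trans_lt (by omega))
    have hmpos : 0 < m := by
      by_contra! hle
      nlinarith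
    lift m to ℕ using hmpos.le
    have hmC : (m : ℤ) ≤ C := by nlinarith
    have heq : m • eX = eH := by
      refine Expo.ext ?_ ?_
      · rw [map_nsmul, hm, nsmul_eq_mul]; ring
      · rw [map_nsmul, nsmul_eq_mul]
        apply mul_right_cancel₀ hXpos.ne'
        rw [expoDet] at hdet0
        rw [hm] at hdet0
        linarith
    have hm1 : 1 ≤ m := by exact_mod_cast hmpos
    have hmk : (m : k) ≠ 0 := by
      rw [Ne, CharP.cast_eq_zero_iff k p]
      intro hdvd
      have := Nat.le_of_dvd (by omega) hdvd
      omega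
    obtain ⟨E, hEx, hEh⟩ := exists_shear hv0 (-β / α ^ m) hm1
    refine ⟨E, shear_mem_W hv0 hfact hm1 hmk hEx hEh, ?_, ?_⟩
    · simpa using hψ.mul (isPoissonUpTo_of_shear hv0 hEx hEh)
    · rw [AlgEquiv.mul_apply, hEh, map_add, map_smul, map_pow, map_add, map_smul, map_pow]
      refine (hH.add (((hX.pow m).congr rfl heq rfl).smul (-β / α ^ m))).congr rfl rfl ?_
      rw [div_mul_cancel₀ _ (pow_ne_zero m hα), add_neg_cancel]
  · left
    have h1 := hbr.unique hX (mul_ne_zero hε (mul_ne_zero hdet (mul_ne_zero hβ hα))) hα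
    have h2 : eH = eh := by
      rw [add_sub_assoc, add_comm, sub_add, sub_eq_self, sub_eq_zero] at h1
      exact h1.symm
    subst h2
    have h3 : eX = ex := eq_ex_of_sum_eq hv hX hα hY hη hsum
      (fun h0 => hdet (by rw [h0, Int.cast_zero])) hab
    subst h3
    exact ⟨α, β, hα, hβ, hX, hH⟩

/-- The descent is lexicographic in weight and h-degree, encoded as wt² + hdeg: since hdeg ≤ wt/2, a
drop in weight outweighs any rise in h-degree. Exchanges met on the way are moved to the right end,
where only their parity remains. -/
theorem exists_isReduced (hv : 1 ≤ v.natDegree) {C : ℕ} (hCp : C * C < p)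
    (hfact : ∀ j ≤ v.natDegree, (j.factorial : k) ≠ 0) (N : ℕ) {ε : k} (hε : ε ≠ 0)
    {ψ : B v ≃ₐ[k] B v} (hψ : IsPoissonUpTo ε ψ) {eH : Expo} {β : k} (hβ : β ≠ 0)
    (hH : Lead (iota v (ψ (h v))) eH β) (hC : v.natDegree * wt eH ≤ C)
    (hN : wt eH * wt eH + hdeg eH < N) :
    (∃ w ∈ W v, IsPoissonUpTo ε (ψ * w) ∧ IsReduced (ψ * w)) ∨
      ∃ w ∈ W v, IsPoissonUpTo (-ε) (ψ * w * swap v) ∧ IsReduced (ψ * w * swap v) := by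
  induction N generalizing ε ψ eH β with
  | zero =>
    have := (wt_nonneg_of_lead hv hH hβ).1
    rw [Nat.cast_zero] at hN
    nlinarith [mul_self_nonneg (wt eH)]
  | succ N ih =>
    have hv0 := ne_zero_of_natDegree_pos hv
    obtain ⟨eX, α, hα, -, hX⟩ := exists_lead_map hv ψ (b := x v) x_ne_algebraMap
    obtain ⟨eY, η, hη, -, hY⟩ := exists_lead_map hv ψ (b := y v) y_ne_algebraMap
    have hHpos := wt_pos_of_lead hv hH hβ (map_ne_algebraMap h_ne_algebraMap ψ)
    -- the inductive step once `x` has the smaller leading exponent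
    have step : ∀ (ε : k) (ψ : B v ≃ₐ[k] B v), ε ≠ 0 → IsPoissonUpTo ε ψ →
        ∀ (eX eY : Expo) (α η : k), α ≠ 0 → η ≠ 0 → Lead (iota v (ψ (x v))) eX α →
        Lead (iota v (ψ (y v))) eY η → Lead (iota v (ψ (h v))) eH β → wt eX ≤ wt eY →
        (∃ w ∈ W v, IsPoissonUpTo ε (ψ * w) ∧ IsReduced (ψ * w)) ∨
          ∃ w ∈ W v, IsPoissonUpTo (-ε) (ψ * w * swap v) ∧ IsReduced (ψ * w * swap v) := by
      intro ε ψ hε hψ eX eY α η hα hη hX hY hH hab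
      rcases isReduced_or_exists_shear p hv hCp hfact hε hψ hα hη hβ hX hY hH hab hC with
        hred | ⟨E, hE, hEψ, hEh⟩
      · exact Or.inl ⟨1, one_mem _, by simpa using hψ, by simpa using hred⟩
      · obtain ⟨eH', β', hβ', hpos', hH'⟩ := exists_lead_map hv (ψ * E) (b := h v) h_ne_algebraMap
        have hlt := hEh.lt_of_zero hH' hβ'
        obtain ⟨h1, h2, -⟩ := wt_nonneg_of_lead hv hH' hβ'
        obtain ⟨h3, -, -⟩ := wt_nonneg_of_lead hv hH hβ
        have hn : (1 : ℤ) ≤ v.natDegree := by exact_mod_cast hv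
        have hC' : v.natDegree * wt eH' ≤ C :=
          (mul_le_mul_of_nonneg_left (wt_mono hlt.le) (by omega)).trans hC
        have hN' : wt eH' * wt eH' + hdeg eH' < N := by
          push_cast at hN
          rcases Expo.lt_iff.mp hlt with h4 | ⟨h4, h5⟩
          · nlinarith
          · rw [h4]; omega
        rcases ih hε hEψ hβ' hH' hC' hN' with ⟨w, hw, hw'⟩ | ⟨w, hw, hw'⟩
        · exact Or.inl ⟨E * w, mul_mem hE hw, by rwa [← mul_assoc]⟩
        · exact Or.inr ⟨E * w, mul_mem hE hw, by rwa [← mul_assoc]⟩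
    rcases le_total (wt eX) (wt eY) with hab | hab
    · exact step ε ψ hε hψ eX eY α η hα hη hX hY hH hab
    · have hs : IsPoissonUpTo (-ε) (ψ * swap v) := by
        simpa using hψ.mul (isPoissonUpTo_swap hv0)
      -- A leading exchange is traded for a trailing one by conjugating the element of W.
      have hss : ∀ w, ψ * (swap v * w * swap v) * swap v = ψ * swap v * w := fun w => by
        simp only [mul_assoc, swap_mul_swap, mul_one]
      rcases step (-ε) (ψ * swap v) (neg_ne_zero.mpr hε) hs eY eX η α hη hα
        (by simpa [AlgEquiv.mul_apply] using hY) (by simpa [AlgEquiv.mul_apply] using hX)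
        (by simpa [AlgEquiv.mul_apply] using hH) hab with ⟨w, hw, hw'⟩ | ⟨w, hw, hw'⟩
      · exact Or.inr ⟨swap v * w * swap v, swap_conj_mem_W hv0 hw, by rwa [hss]⟩
      · refine Or.inl ⟨swap v * w * swap v, swap_conj_mem_W hv0 hw, ?_⟩
        rw [neg_neg] at hw'
        simpa only [mul_assoc] using hw'

end Descent

/-! ### Degree bounds and identification of the affine automorphisms -/

section Final

variable {k : Type*} [Field k] {v : k[X]}

/-- An exponent dominating those of the leading terms of the three generators. -/
def genExpo (n : ℕ) : Expo := toLex (3 * (n : ℤ), 1)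

theorem exists_lead_proj (hv : 1 ≤ v.natDegree) (q : MvPolynomial (Fin 3) k) {d : ℕ}
    (hq : q.totalDegree ≤ d) :
    ∃ c, Lead (iota v (proj v q)) (d • genExpo v.natDegree) c := by
  set E : Expo := genExpo v.natDegree with hE
  have hn : (1 : ℤ) ≤ v.natDegree := by exact_mod_cast hv
  have hwE : wt E = 3 * v.natDegree := rfl
  have hdE : hdeg E = 1 := rfl
  have hEpos : 0 < E := Expo.lt_iff.mpr (Or.inl (by rw [map_zero, hwE]; omega))
  have hle : ∀ {f : AddMonoidAlgebra k Expo} {e e' : Expo} {c : k}, Lead f e c → e ≤ e' →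
      ∃ c', Lead f e' c' := by
    intro f e e' c hl hee
    rcases hee.eq_or_lt with rfl | hlt
    · exact ⟨c, hl⟩
    · exact ⟨0, hl.of_lt hlt⟩
  have hgen : ∀ i : Fin 3, ∃ c, Lead (iota v (proj v (MvPolynomial.X i))) E c := by
    intro i
    fin_cases i
    · refine hle (lead_iota_x v) (Expo.le_iff.mpr ?_)
      rw [hwE, wt_ex]; left; omega
    · refine hle (lead_iota_y v) (Expo.le_iff.mpr ?_)
      rw [hwE, map_sub, map_nsmul, wt_eh, wt_ex, nsmul_eq_mul]; left; omega
    · refine hle (lead_iota_h v) (Expo.le_iff.mpr ?_)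
      rw [hwE, hdE, wt_eh, hdeg_eh]; omega
  choose c hc using hgen
  have hmon : ∀ s ∈ q.support, ∃ c', Lead (iota v (proj v (MvPolynomial.monomial s (q.coeff s))))
      (d • E) c' := by
    intro s hs
    have h1 : (s 0 + s 1 + s 2) ≤ d := by
      refine le_trans (le_of_eq ?_) ((MvPolynomial.le_totalDegree hs).trans hq)
      rw [Finsupp.sum_fintype _ _ (fun _ => rfl), Fin.sum_univ_three]
    have h2 := ((((hc 0).pow (s 0)).mul ((hc 1).pow (s 1))).mul ((hc 2).pow (s 2))).smul (q.coeff s)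
    rw [← add_nsmul, ← add_nsmul] at h2
    refine hle (h2.congr ?_ rfl rfl) (nsmul_le_nsmul_left hEpos.le h1)
    rw [MvPolynomial.monomial_eq, ← MvPolynomial.smul_eq_C_mul, map_smul, map_smul,
      Finsupp.prod_fintype _ _ (fun _ => pow_zero _), Fin.prod_univ_three]
    simp only [map_mul, map_pow]
  choose! c' hc' using hmon
  refine ⟨∑ s ∈ q.support, c' s, ?_⟩
  conv in proj v q => rw [q.as_sum]
  rw [map_sum, map_sum]
  exact Lead.sum _ _ _ hc'

/-- Every generator has weight at most 3n, and the infimum defining `deg` is attained. -/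
theorem wt_le_of_deg_le (hv : 1 ≤ v.natDegree) {b : B v} {d : ℕ} (hb : deg b ≤ d) {e : Expo} {c : k}
    (hl : Lead (iota v b) e c) (hc : c ≠ 0) : wt e ≤ 3 * d * v.natDegree := by
  have hne : {n | ∃ q : MvPolynomial (Fin 3) k, proj v q = b ∧ q.totalDegree = n}.Nonempty := by
    obtain ⟨q, hq⟩ := proj_surjective v b
    exact ⟨_, q, hq, rfl⟩
  obtain ⟨q, rfl, hq⟩ := Nat.sInf_mem hne
  obtain ⟨c', hc'⟩ := exists_lead_proj hv q (d := d) (hq.le.trans hb)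
  have h1 := wt_mono (hl.le hc' hc)
  rw [map_nsmul, nsmul_eq_mul] at h1
  refine h1.trans (le_of_eq ?_)
  change (d : ℤ) * (3 * v.natDegree) = _
  ring

/-- The Hasse derivative of order n - 1 is linear with slope n times the leading coefficient, and
translation invariance makes it agree at a and 0. -/
theorem eq_zero_of_comp_X_add_C (hv : 1 ≤ v.natDegree) (hn : (v.natDegree : k) ≠ 0) {a : k}
    (e : v.comp (X + C a) = v) : a = 0 := by
  set L := hasseDeriv (v.natDegree - 1) v with hL
  have hLdeg : L.natDegree ≤ 1 := (natDegree_hasseDeriv_le v _).trans (by omega)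
  have hL1 : L.coeff 1 = v.natDegree * v.leadingCoeff := by
    rw [hL, hasseDeriv_coeff, add_comm, Nat.sub_add_cancel hv,
      Nat.choose_symm_of_eq_add (by omega : v.natDegree = (v.natDegree - 1) + 1), Nat.choose_one_right,
      leadingCoeff]
  have h1 : L.eval a = L.eval 0 := by
    rw [hL, ← taylor_coeff, ← taylor_coeff, taylor_zero, taylor_apply, e]
  rw [eq_X_add_C_of_natDegree_le_one hLdeg] at h1
  simp only [eval_add, eval_mul, eval_C, eval_X, mul_zero, add_left_inj, hL1] at h1
  simpa [hn, ne_zero_of_natDegree_pos hv] using h1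

/-- An even number of exchanges leads to ε = 1 and a diagonal map, an odd number to ε = -1 and a
reflexive v. The bound K controls n wt eH, which equals wt eX + wt eY. -/
theorem mem_of_isPoisson [Infinite k] (p : ℕ) [Fact p.Prime] [CharP k p] (hv : 1 ≤ v.natDegree)
    {K : ℕ} (hKp : K * K < p) (hnp : v.natDegree < p) (hp : 3 < p) {φ : B v ≃ₐ[k] B v}
    (hφ : IsPoisson φ) {eX eY : Expo} {α η : k} (hα : α ≠ 0) (hη : η ≠ 0)
    (hX : Lead (iota v (φ (x v))) eX α) (hY : Lead (iota v (φ (y v))) eY η)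
    (hK : wt eX + wt eY ≤ K) :
    φ ∈ W v ∨ ∃ (a : k) (ha : IsReflexiveAt v a), ∃ w ∈ W v, φ = Omega v a ha * w := by
  have hv0 := ne_zero_of_natDegree_pos hv
  have hfact : ∀ j ≤ v.natDegree, (j.factorial : k) ≠ 0 := fun j hj =>
    factorial_ne_zero_of_lt_char p (hj.trans_lt hnp)
  have hnk : ∀ m : ℕ, 1 ≤ m → m < p → (m : k) ≠ 0 := by
    intro m hm hmp
    rw [Ne, CharP.cast_eq_zero_iff k p]
    intro hdvd
    have := Nat.le_of_dvd (by omega) hdvd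
    omega
  have h2 : (2 : k) ≠ 0 := by exact_mod_cast hnk 2 (by omega) (by omega)
  have h3 : (3 : k) ≠ 0 := by exact_mod_cast hnk 3 (by omega) (by omega)
  have hφ' : IsPoissonUpTo (1 : k) φ := fun f g => by rw [hφ, one_smul]
  obtain ⟨eH, β, hβ, hHpos, hH⟩ := exists_lead_map hv φ (b := h v) h_ne_algebraMap
  have hsum := congrArg wt (lead_sum_eq hv hα hη hβ hX hY hH (pos_of_wt_pos hHpos))
  rw [map_add, map_nsmul, nsmul_eq_mul] at hsum
  rcases exists_isReduced p hv hKp hfact ((wt eH * wt eH + hdeg eH).toNat + 1) one_ne_zero hφ' hβ hH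
      (by rw [← hsum]; exact hK) (by push_cast; omega) with
    ⟨w, hw, hψ, α', β', hα', hβ', hX', hH'⟩ | ⟨w, hw, hψ, α', β', hα', hβ', hX', hH'⟩
  · left
    obtain ⟨w', hw', t, q, ht, htx, hqh⟩ :=
      exists_isAffine hv hfact h2 h3 (by ring) hψ hα' hβ' hX' hH'
    have hq0 : q = 0 := by
      apply eq_zero_of_comp_X_add_C hv (hnk _ hv hnp)
      simpa using comp_eq_of_map_eq hv one_ne_zero htx hqh
    subst hq0
    have hdiag : φ * w * w' = diagonal v (Units.mk0 t ht) := by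
      refine algEquiv_ext_of_x_h hv0 ?_ ?_
      · rw [htx]; simp [diagonal, lift_x]
      · rw [hqh]; simp [diagonal, lift_h]
    have : φ = diagonal v (Units.mk0 t ht) * (w * w')⁻¹ := by
      rw [← hdiag, mul_assoc φ w w', mul_inv_cancel_right]
    rw [this]
    exact mul_mem (Subgroup.subset_closure (Or.inr ⟨_, rfl⟩)) (inv_mem (mul_mem hw hw'))
  · right
    obtain ⟨w', hw', t, q, ht, htx, hqh⟩ :=
      exists_isAffine hv hfact h2 h3 (by ring) hψ hα' hβ' hX' hH'
    have hcomp := comp_eq_of_map_eq hv (neg_ne_zero.mpr one_ne_zero) htx hqh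
    have hone : ((-1 : k[X]) ^ v.natDegree) * (-1) ^ v.natDegree = 1 := by
      rw [← mul_pow]; simp
    have ha : IsReflexiveAt v q := by
      rw [IsReflexiveAt]
      have h4 : C (-1 : k) * X + C q = C q - X := by simp; ring
      rw [h4] at hcomp
      rw [hcomp, C_pow, C_neg, C_1, ← mul_assoc, hone, one_mul]
    refine ⟨q, ha, ?_⟩
    -- Chosen so that Ω after the diagonal map sends y to tx.
    set s : k := t⁻¹ * (-1) ^ v.natDegree with hs
    have hs0 : s ≠ 0 := mul_ne_zero (inv_ne_zero ht) (pow_ne_zero _ (neg_ne_zero.mpr one_ne_zero))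
    have hsinv : s⁻¹ * (-1) ^ v.natDegree = t := by
      rw [hs, mul_inv, inv_inv, mul_assoc, inv_mul_cancel₀ (pow_ne_zero _ (neg_ne_zero.mpr
        one_ne_zero)), mul_one]
    have hdiag : φ * w * swap v * w' = Omega v q ha * diagonal v (Units.mk0 s hs0) * swap v := by
      refine algEquiv_ext_of_x_h hv0 ?_ ?_
      · rw [htx]
        simp only [AlgEquiv.mul_apply, swap_x]
        simp only [diagonal, Omega, AlgEquiv.ofAlgHom_apply, lift_y, map_smul, Units.val_inv_eq_inv_val,
          Units.val_mk0]
        rw [← hsinv, Algebra.smul_def, Algebra.smul_def, map_mul, map_pow, map_neg, map_one]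
        ring
      · rw [hqh]
        simp only [AlgEquiv.mul_apply, swap_h]
        simp only [diagonal, Omega, AlgEquiv.ofAlgHom_apply, lift_h]
        rw [neg_one_smul]; ring
    set u := swap v * w' * swap v with hu
    have hum : u ∈ W v := swap_conj_mem_W hv0 hw'
    have h5 : φ * w * u = Omega v q ha * diagonal v (Units.mk0 s hs0) := by
      have := congrArg (fun θ => θ * swap v) hdiag
      simp only [mul_assoc, swap_mul_swap, mul_one] at this
      simpa only [hu, mul_assoc] using this
    refine ⟨diagonal v (Units.mk0 s hs0) * (w * u)⁻¹, mul_mem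
      (Subgroup.subset_closure (Or.inr ⟨_, rfl⟩)) (inv_mem (mul_mem hw hum)), ?_⟩
    rw [← mul_assoc, ← h5, mul_assoc φ, mul_inv_cancel_right]

/-- Two reflections preserving v up to sign compose to a translation preserving v. Hence the a
produced by the descent is the given one. -/
theorem IsReflexiveAt.unique (hv : 1 ≤ v.natDegree) (hn : (v.natDegree : k) ≠ 0) {a b : k}
    (ha : IsReflexiveAt v a) (hb : IsReflexiveAt v b) : a = b := by
  have hone : ((-1 : k[X]) ^ v.natDegree) * (-1) ^ v.natDegree = 1 := by
    rw [← mul_pow]; simp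
  have h1 : v.comp (C a - X) = v.comp (C b - X) := by
    rw [IsReflexiveAt] at ha hb
    have h2 := ha.symm.trans hb
    have h3 := congrArg (fun P => (-1) ^ v.natDegree * P) h2
    simpa only [← mul_assoc, hone, one_mul] using h3
  have h2 := congrArg (fun P => P.comp (C b - X)) h1
  simp only [comp_assoc, sub_comp, C_comp, X_comp] at h2
  rw [← sub_eq_zero]
  apply eq_zero_of_comp_X_add_C hv hn
  have e1 : (X + C (a - b) : k[X]) = C a - (C b - X) := by rw [C_sub]; ring
  have e2 : C b - (C b - X) = (X : k[X]) := by ring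
  rw [e1, h2, e2, comp_X]

end Final

end TypeAPoisson

/-! ### The main theorem -/

theorem mainTheorem6 (d : ℕ) :
    ∃ N : ℕ, ∀ p : ℕ, p.Prime → N < p →
      ∀ (k : Type*) [Field k] [IsAlgClosed k] [CharP k p] (v : Polynomial k),
        1 ≤ v.natDegree → v.natDegree ≤ d →
        ∀ φ : TypeAPoisson.B v ≃ₐ[k] TypeAPoisson.B v,
          TypeAPoisson.IsPoisson φ →
          TypeAPoisson.deg (φ (TypeAPoisson.x v)) ≤ d →
          TypeAPoisson.deg (φ (TypeAPoisson.y v)) ≤ d →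
          (∀ (a : k) (ha : TypeAPoisson.IsReflexiveAt v a),
              φ ∈ Subgroup.closure
                ((TypeAPoisson.W v : Set (TypeAPoisson.B v ≃ₐ[k] TypeAPoisson.B v)) ∪
                  {TypeAPoisson.Omega v a ha})) ∧
            (¬ TypeAPoisson.IsReflexive v → φ ∈ TypeAPoisson.W v) := by
  -- φ(x) and φ(y) have weights at most 3dn ≤ 3d², so K = 6d² bounds their sum and p > K² is needed;
  -- the summands d and 3 make n < p and p > 3.
  refine ⟨6 * d * d * (6 * d * d) + d + 3, ?_⟩
  intro p hp hNp k _ _ _ v hv hvd φ hφ hx hy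
  have : Fact p.Prime := ⟨hp⟩
  have : Infinite k := IsAlgClosed.instInfinite
  obtain ⟨eX, α, hα, -, hX⟩ := TypeAPoisson.exists_lead_map hv φ TypeAPoisson.x_ne_algebraMap
  obtain ⟨eY, η, hη, -, hY⟩ := TypeAPoisson.exists_lead_map hv φ TypeAPoisson.y_ne_algebraMap
  have hXd := TypeAPoisson.wt_le_of_deg_le hv hx hX hα
  have hYd := TypeAPoisson.wt_le_of_deg_le hv hy hY hη
  have hnk : (v.natDegree : k) ≠ 0 := by
    rw [Ne, CharP.cast_eq_zero_iff k p]
    intro hdvd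
    have := Nat.le_of_dvd (by omega) hdvd
    omega
  have hsum : TypeAPoisson.wt eX + TypeAPoisson.wt eY ≤ ((6 * d * d : ℕ) : ℤ) := by
    have h1 : (v.natDegree : ℤ) ≤ d := by exact_mod_cast hvd
    have h2 : (3 * d * v.natDegree : ℤ) ≤ 3 * d * d := mul_le_mul_of_nonneg_left h1 (by positivity)
    push_cast
    linarith
  have key := TypeAPoisson.mem_of_isPoisson p hv (K := 6 * d * d) (by omega) (by omega) (by omega)
    hφ hα hη hX hY hsum
  constructor
  · intro a ha
    rcases key with hW | ⟨b, hb, w, hw, rfl⟩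
    · exact Subgroup.subset_closure (Or.inl hW)
    · obtain rfl := TypeAPoisson.IsReflexiveAt.unique hv hnk ha hb
      exact mul_mem (Subgroup.subset_closure (Or.inr rfl)) (Subgroup.subset_closure (Or.inl hw))
  · intro hnr
    rcases key with hW | ⟨b, hb, -⟩
    · exact hW
    · exact absurd ⟨b, hb⟩ hnr
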